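/- Let $N\ge 1$, $1<p<\infty$ and $0<s<1$. For $u\in C^\infty_0(\mathbb{R}^N)$ set $$[u]^p_{W^{s,p}(\mathbb{R}^N)}=\iint_{\mathbb{R}^N\times\mathbb{R}^N}\frac{|u(x)-u(y)|^p}{|x-y|^{N+sp}}\,dx\,dy .$$ For an open set $\Omega\subset\mathbb{R}^N$, let $\mathcal{D}^{s,p}_0(\Omega)$ be the completion of $C^\infty_0(\Omega)$ (smooth real functions with compact support in $\Omega$) with respect to the norm $u\mapsto [u]_{W^{s,p}(\mathbb{R}^N)}$, let $d_\Omega(x)=\inf_{y\in\partial\Omega}|x-y|$ for $x\in\Omega$ (with $d_\Omega=+\infty$ if $\Omega=\mathbb{R}^N$), and let $$\lambda^s_{1,p}(\Omega)=\inf_{u\in C^\infty_0(\Omega)}\Big\{[u]^p_{W^{s,p}(\mathbb{R}^N)} : \int_\Omega|u|^p\,dx=1\Big\}$$ be the first eigenvalue of the fractional $p$-Laplacian of order $s$ in $\Omega$. Call a number $\mathcal{C}>0$ a Hardy constant for $(N,p)$ if for every $\sigma\in(0,1)$, every open convex set $K\subsetneq\mathbb{R}^N$ and every $u\in C^\infty_0(K)$,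 $$\frac{\mathcal{C}}{\sigma(1-\sigma)}\int_K\frac{|u|^p}{d_K^{\sigma p}}\,dx\le [u]^p_{W^{\sigma,p}(\mathbb{R}^N)} .$$ For all $N\ge1$ and $1<p<\infty$ a Hardy constant exists. Moreover, let $K\subset\mathbb{R}^N$ be a nonempty open convex set with finite inradius $$R_K:=\sup_{x\in K}d_K(x)<+\infty .$$ Then $\mathcal{D}^{s,p}_0(K)$ is a functional space, continuously embedded in $L^p(K)$: there is an injective continuous linear map $\mathcal{D}^{s,p}_0(K)\to L^p(K)$ that sends (the class of) each $u\in C^\infty_0(K)$ to $u$. Moreover, for every Hardy constant $\mathcal{C}$ for $(N,p)$, $$\frac{\mathcal{C}}{R_K^{sp}}\le s(1-s)\,\lambda^s_{1,p}(K).$$ -/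

import Mathlib

open MeasureTheory TopologicalSpace Set
open scoped ENNReal Distributions

noncomputable section

namespace FracHardy

/-- The Euclidean space `ℝ^N`. -/
abbrev Eucl (N : ℕ) : Type := EuclideanSpace ℝ (Fin N)

/-- The `p`-th power of the Gagliardo seminorm on the whole space,
`[u]^p = ∬ |u(x) - u(y)|^p / |x - y|^(N + s p) dx dy`, with values in `[0, ∞]`. -/
def energy {N : ℕ} (s p : ℝ) (u : Eucl N → ℝ) : ℝ≥0∞ :=
  ∫⁻ z : Eucl N × Eucl N,
    ENNReal.ofReal (|u z.1 - u z.2| ^ p / ‖z.1 - z.2‖ ^ ((N : ℝ) + s * p))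

/-- The Gagliardo seminorm `[u]`. -/
def gagliardo {N : ℕ} (s p : ℝ) (u : Eucl N → ℝ) : ℝ := (energy s p u).toReal ^ (1 / p)

/-- The distance of a point of `Ω` from the boundary of `Ω` (equal to `∞` if the boundary is
empty, that is, if `Ω` is the whole space). It is only used at points of `Ω`. -/
def bdryDist {N : ℕ} (Ω : Opens (Eucl N)) (x : Eucl N) : ℝ≥0∞ :=
  Metric.infEDist x (frontier (Ω : Set (Eucl N)))

/-- The inradius `sup_{x ∈ Ω} d_Ω(x)`, with values in `[0, ∞]`. -/
def inradius {N : ℕ} (Ω : Opens (Eucl N)) : ℝ≥0∞ := ⨆ x ∈ Ω, bdryDist Ω x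

/-- The first eigenvalue of the fractional `p`-Laplacian of order `s`:
the infimum of `[u]^p` over `u ∈ C_c^∞(Ω)` with `∫_Ω |u|^p = 1`. -/
def firstEigenvalue {N : ℕ} (s p : ℝ) (Ω : Opens (Eucl N)) : ℝ≥0∞ :=
  ⨅ (u : 𝓓(Ω, ℝ)) (_ : ∫ x in (Ω : Set (Eucl N)), |u x| ^ p = 1), energy s p u

/-- `C` is an admissible constant, for dimension `N` and exponent `p`, in the fractional Hardy
inequality on convex sets
`C / (s (1 - s)) * ∫_K |u|^p / d_K^(s p) ≤ [u]^p` for all `u ∈ C_c^∞(K)`: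
the same positive `C` serves every `s ∈ (0, 1)` and every open convex `K ≠ ℝ^N`. -/
def IsHardyConstant (N : ℕ) (p C : ℝ) : Prop :=
  0 < C ∧ ∀ s ∈ Ioo (0 : ℝ) 1, ∀ K : Opens (Eucl N),
    Convex ℝ (K : Set (Eucl N)) → (K : Set (Eucl N)) ≠ univ → ∀ u : 𝓓(K, ℝ),
      ENNReal.ofReal (C / (s * (1 - s))) *
          ∫⁻ x in (K : Set (Eucl N)), ENNReal.ofReal (|u x| ^ p) / bdryDist K x ^ (s * p)
        ≤ energy s p u

section Seminorm

variable {N : ℕ} {s p : ℝ}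

/-- The difference quotient whose `L^p` norm is the Gagliardo seminorm. -/
def diffQuot (s p : ℝ) (u : Eucl N → ℝ) (z : Eucl N × Eucl N) : ℝ :=
  (u z.1 - u z.2) / ‖z.1 - z.2‖ ^ (((N : ℝ) + s * p) / p)

theorem energy_eq (hp : 1 < p) (u : Eucl N → ℝ) :
    energy s p u = eLpNorm (diffQuot s p u) (ENNReal.ofReal p) volume ^ p := by
  have hp0 : 0 < p := by linarith
  rw [eLpNorm_eq_lintegral_rpow_enorm_toReal (by simpa using hp0) ENNReal.ofReal_ne_top,
    ENNReal.toReal_ofReal hp0.le, ← ENNReal.rpow_mul, one_div, inv_mul_cancel₀ hp0.ne',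
    ENNReal.rpow_one, energy]
  refine lintegral_congr fun z => ?_
  rw [Real.enorm_eq_ofReal_abs, ENNReal.ofReal_rpow_of_nonneg (abs_nonneg _) hp0.le, diffQuot,
    abs_div, Real.div_rpow (abs_nonneg _) (abs_nonneg _), abs_of_nonneg (by positivity : (0 : ℝ) ≤
    ‖z.1 - z.2‖ ^ (((N : ℝ) + s * p) / p)), ← Real.rpow_mul (norm_nonneg _),
    div_mul_cancel₀ _ hp0.ne']

theorem measurable_diffQuot {u : Eucl N → ℝ} (hu : Continuous u) :
    Measurable (diffQuot s p u) := by
  unfold diffQuot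
  have := hu.measurable
  fun_prop

theorem gagliardo_eq (hp : 1 < p) (u : Eucl N → ℝ) :
    gagliardo s p u = (eLpNorm (diffQuot s p u) (ENNReal.ofReal p) volume).toReal := by
  have hp0 : 0 < p := by linarith
  rw [gagliardo, energy_eq hp, ← ENNReal.toReal_rpow, ← Real.rpow_mul ENNReal.toReal_nonneg,
    mul_one_div_cancel hp0.ne', Real.rpow_one]

/-- Integrability of the radial majorant. -/
theorem kernel_lt_top (hN : 1 ≤ N) (hs : s ∈ Ioo (0 : ℝ) 1) (hp : 1 < p) :
    ∫⁻ h : Eucl N, ENNReal.ofReal (min (‖h‖ ^ p) 1 / ‖h‖ ^ ((N : ℝ) + s * p)) < ∞ := by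
  have hp0 : 0 < p := by linarith
  have hsp : 0 < s * p := mul_pos hs.1 hp0
  have hsp' : s * p < p := by nlinarith [hs.2]
  have hNR : (1 : ℝ) ≤ N := by exact_mod_cast hN
  have hm : Measurable fun h : Eucl N => min (‖h‖ ^ p) 1 / ‖h‖ ^ ((N : ℝ) + s * p) := by
    fun_prop
  have h1 : IntegrableOn (fun h : Eucl N => min (‖h‖ ^ p) 1 / ‖h‖ ^ ((N : ℝ) + s * p))
      (Metric.ball 0 1) := by
    refine integrableOn_ball_of_norm_le_rpow (C := 1) (α := (N : ℝ) + s * p - p)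
      (by simpa using hN) (by simp; linarith) ?_ hm.aestronglyMeasurable
    refine Filter.Eventually.of_forall fun h => ?_
    rw [Real.norm_of_nonneg (by positivity), one_mul]
    rcases eq_or_ne h 0 with rfl | h0
    · rw [norm_zero, Real.zero_rpow (by positivity : (N : ℝ) + s * p ≠ 0), div_zero]
      positivity
    · have hpos : 0 < ‖h‖ := norm_pos_iff.2 h0
      rw [neg_sub, Real.rpow_sub hpos]
      gcongr
      exact min_le_left _ _
  rw [← lintegral_add_compl _ (Metric.isOpen_ball (x := (0 : Eucl N)) (ε := 1)).measurableSet]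
  refine ENNReal.add_lt_top.2 ⟨?_, ?_⟩
  · have := h1.2
    rw [hasFiniteIntegral_iff_ofReal (Filter.Eventually.of_forall fun h => by positivity)] at this
    exact this
  · have h2 := finite_integral_one_add_norm (E := Eucl N) (μ := volume) (r := (N : ℝ) + s * p)
      (by simp; linarith)
    have h3 : ENNReal.ofReal ((2 : ℝ) ^ ((N : ℝ) + s * p)) *
        ∫⁻ x : Eucl N, ENNReal.ofReal ((1 + ‖x‖) ^ (-((N : ℝ) + s * p))) < ∞ :=
      ENNReal.mul_lt_top ENNReal.ofReal_lt_top h2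
    refine lt_of_le_of_lt ?_ h3
    rw [← lintegral_const_mul _ (by fun_prop)]
    refine le_trans (setLIntegral_mono' (measurableSet_ball.compl) fun h hh => ?_)
      (setLIntegral_le_lintegral _ _)
    rw [← ENNReal.ofReal_mul (by positivity)]
    have hh1 : 1 ≤ ‖h‖ := by simpa using hh
    have hpos : 0 < ‖h‖ := by linarith
    refine ENNReal.ofReal_le_ofReal ?_
    rw [Real.rpow_neg (by positivity), ← div_eq_mul_inv, ← Real.div_rpow (by norm_num)
      (by positivity)]
    calc min (‖h‖ ^ p) 1 / ‖h‖ ^ ((N : ℝ) + s * p) ≤ 1 / ‖h‖ ^ ((N : ℝ) + s * p) := by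
          gcongr; exact min_le_right _ _
      _ = (1 / ‖h‖) ^ ((N : ℝ) + s * p) := by
          rw [Real.div_rpow (by norm_num) hpos.le, Real.one_rpow]
      _ ≤ (2 / (1 + ‖h‖)) ^ ((N : ℝ) + s * p) := by
          refine Real.rpow_le_rpow (by positivity) ?_ (by positivity)
          rw [div_le_div_iff₀ hpos (by positivity)]
          linarith

/-- Test functions have finite Gagliardo seminorm. -/
theorem energy_lt_top (hs : s ∈ Ioo (0 : ℝ) 1) (hp : 1 < p) {Ω : Opens (Eucl N)}
    (u : 𝓓(Ω, ℝ)) : energy s p u < ∞ := by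
  have hp0 : 0 < p := by linarith
  rcases Nat.eq_zero_or_pos N with rfl | hN
  · have : energy s p u = 0 := by
      rw [energy]
      refine (lintegral_congr fun z => ?_).trans lintegral_zero
      rw [Subsingleton.elim z.1 z.2]
      simp [Real.zero_rpow hp0.ne']
    rw [this]; exact ENNReal.zero_lt_top
  obtain ⟨L, hL⟩ := (u.contDiff.of_le (m := 1) (by simp)).lipschitzWith_of_hasCompactSupport
    u.hasCompactSupport one_ne_zero
  obtain ⟨M, hM⟩ := u.continuous.bounded_above_of_compact_support u.hasCompactSupport
  have hM0 : 0 ≤ M := (norm_nonneg _).trans (hM 0)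
  set A : ℝ := max (L : ℝ) (2 * M) with hA
  have hA0 : 0 ≤ A := le_max_of_le_left L.2
  have hb : ∀ x y, |u x - u y| ^ p ≤ A ^ p * min (‖x - y‖ ^ p) 1 := by
    intro x y
    rcases le_total (‖x - y‖ ^ p) 1 with h | h
    · rw [min_eq_left h, ← Real.mul_rpow hA0 (norm_nonneg _)]
      refine Real.rpow_le_rpow (abs_nonneg _) ?_ hp0.le
      have := hL.dist_le_mul x y
      rw [Real.dist_eq, dist_eq_norm] at this
      exact this.trans (by gcongr; exact le_max_left _ _)
    · rw [min_eq_right h, mul_one]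
      refine Real.rpow_le_rpow (abs_nonneg _) ?_ hp0.le
      have h1 := hM x
      have h2 := hM y
      rw [Real.norm_eq_abs] at h1 h2
      exact (abs_sub _ _).trans ((by linarith : _ ≤ 2 * M).trans (le_max_right _ _))
  set B : Set (Eucl N) := tsupport u with hB
  have hBc : IsCompact B := u.hasCompactSupport
  have hBm : MeasurableSet B := (isClosed_tsupport u).measurableSet
  set g : Eucl N → ℝ≥0∞ := fun h =>
    ENNReal.ofReal (A ^ p * (min (‖h‖ ^ p) 1 / ‖h‖ ^ ((N : ℝ) + s * p))) with hg
  have hgm : Measurable g := by fun_prop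
  have hgi : ∫⁻ h, g h < ∞ := by
    have : ∀ h, g h = ENNReal.ofReal (A ^ p) *
        ENNReal.ofReal (min (‖h‖ ^ p) 1 / ‖h‖ ^ ((N : ℝ) + s * p)) := fun h =>
      ENNReal.ofReal_mul (by positivity)
    simp_rw [this]
    rw [lintegral_const_mul _ (by fun_prop)]
    exact ENNReal.mul_lt_top ENNReal.ofReal_lt_top (kernel_lt_top hN hs hp)
  have hpt : ∀ z : Eucl N × Eucl N,
      ENNReal.ofReal (|u z.1 - u z.2| ^ p / ‖z.1 - z.2‖ ^ ((N : ℝ) + s * p)) ≤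
        B.indicator 1 z.1 * g (z.1 - z.2) + B.indicator 1 z.2 * g (z.1 - z.2) := by
    intro z
    have hle : ENNReal.ofReal (|u z.1 - u z.2| ^ p / ‖z.1 - z.2‖ ^ ((N : ℝ) + s * p)) ≤
        g (z.1 - z.2) := by
      refine ENNReal.ofReal_le_ofReal ?_
      rw [← mul_div_assoc]
      gcongr
      exact hb _ _
    by_cases h1 : z.1 ∈ B
    · simpa [h1] using le_add_right hle
    by_cases h2 : z.2 ∈ B
    · simpa [h1, h2] using hle
    · rw [image_eq_zero_of_notMem_tsupport h1, image_eq_zero_of_notMem_tsupport h2]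
      simp [Real.zero_rpow hp0.ne']
  have hind : Measurable (B.indicator (1 : Eucl N → ℝ≥0∞)) := measurable_one.indicator hBm
  refine lt_of_le_of_lt (lintegral_mono hpt) ?_
  rw [lintegral_add_left (by fun_prop)]
  refine ENNReal.add_lt_top.2 ⟨?_, ?_⟩
  · rw [Measure.volume_eq_prod, lintegral_prod _ (by fun_prop)]
    have : ∀ x : Eucl N, ∫⁻ y, B.indicator 1 x * g (x - y) = B.indicator 1 x * ∫⁻ h, g h := by
      intro x
      rw [lintegral_const_mul _ (by fun_prop), lintegral_sub_left_eq_self g x]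
    simp_rw [this]
    rw [lintegral_mul_const _ hind, lintegral_indicator_one hBm]
    exact ENNReal.mul_lt_top hBc.measure_lt_top hgi
  · rw [Measure.volume_eq_prod, lintegral_prod_symm _ (by fun_prop)]
    have : ∀ y : Eucl N, ∫⁻ x, B.indicator 1 y * g (x - y) = B.indicator 1 y * ∫⁻ h, g h := by
      intro y
      rw [lintegral_const_mul _ (by fun_prop), lintegral_sub_right_eq_self g y]
    simp_rw [this]
    rw [lintegral_mul_const _ hind, lintegral_indicator_one hBm]
    exact ENNReal.mul_lt_top hBc.measure_lt_top hgi

theorem eLpNorm_diffQuot_ne_top (hs : s ∈ Ioo (0 : ℝ) 1) (hp : 1 < p) {Ω : Opens (Eucl N)}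
    (u : 𝓓(Ω, ℝ)) : eLpNorm (diffQuot s p u) (ENNReal.ofReal p) volume ≠ ∞ := by
  have h := energy_lt_top hs hp u
  rw [energy_eq hp] at h
  intro h'
  rw [h', ENNReal.top_rpow_of_pos (by linarith)] at h
  exact lt_irrefl _ h

/-- The Gagliardo seminorm as a seminorm on `C_c^∞(Ω)`. -/
def gagliardoSeminorm (hs : s ∈ Ioo (0 : ℝ) 1) (hp : 1 < p) (Ω : Opens (Eucl N)) :
    Seminorm ℝ 𝓓(Ω, ℝ) :=
  Seminorm.of (fun u => gagliardo s p u)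
    (by
      intro u v
      have h1 : (1 : ℝ≥0∞) ≤ ENNReal.ofReal p := by
        rw [← ENNReal.ofReal_one]; exact ENNReal.ofReal_le_ofReal hp.le
      have hadd : diffQuot s p (u + v : 𝓓(Ω, ℝ)) = diffQuot s p u + diffQuot s p v := by
        funext z
        simp only [diffQuot, FunLike.coe_add, Pi.add_apply]
        ring
      simp only [gagliardo_eq hp]
      rw [hadd, ← ENNReal.toReal_add (eLpNorm_diffQuot_ne_top hs hp u)
        (eLpNorm_diffQuot_ne_top hs hp v)]
      exact ENNReal.toReal_mono (ENNReal.add_ne_top.2 ⟨eLpNorm_diffQuot_ne_top hs hp u,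
        eLpNorm_diffQuot_ne_top hs hp v⟩) (eLpNorm_add_le
          (measurable_diffQuot u.continuous).aestronglyMeasurable
          (measurable_diffQuot v.continuous).aestronglyMeasurable h1))
    (by
      intro c u
      have hsmul : diffQuot s p (c • u : 𝓓(Ω, ℝ)) = c • diffQuot s p u := by
        funext z
        simp only [diffQuot, FunLike.coe_smul, Pi.smul_apply, smul_eq_mul]
        ring
      simp only [gagliardo_eq hp]
      rw [hsmul, eLpNorm_const_smul, ENNReal.toReal_mul]
      simp)

/-- The vector space `C_c^∞(Ω)`, carrying the norm `u ↦ [u]` instead of its usual topology. -/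
def GagliardoTest (_hs : s ∈ Ioo (0 : ℝ) 1) (_hp : 1 < p) (Ω : Opens (Eucl N)) : Type :=
  𝓓(Ω, ℝ)

variable (hs : s ∈ Ioo (0 : ℝ) 1) (hp : 1 < p) (Ω : Opens (Eucl N))

instance : AddCommGroup (GagliardoTest hs hp Ω) := inferInstanceAs (AddCommGroup 𝓓(Ω, ℝ))

instance : Module ℝ (GagliardoTest hs hp Ω) := inferInstanceAs (Module ℝ 𝓓(Ω, ℝ))

instance : SeminormedAddCommGroup (GagliardoTest hs hp Ω) :=
  AddGroupSeminorm.toSeminormedAddCommGroup (gagliardoSeminorm hs hp Ω).toAddGroupSeminorm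

theorem norm_gagliardoTest (u : 𝓓(Ω, ℝ)) :
    ‖(show GagliardoTest hs hp Ω from u)‖ = gagliardo s p u := rfl

instance : NormedSpace ℝ (GagliardoTest hs hp Ω) where
  norm_smul_le c u := (map_smul_eq_mul (gagliardoSeminorm hs hp Ω) c u).le

/-- The homogeneous Sobolev-Slobodeckij space `D_0^{s,p}(Ω)`: the completion of `C_c^∞(Ω)` with
respect to the norm `u ↦ [u]`. -/
abbrev D0 : Type := UniformSpace.Completion (GagliardoTest hs hp Ω)

/-- The canonical linear map of `C_c^∞(Ω)` into its completion. -/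
def D0.ofTest : 𝓓(Ω, ℝ) →ₗ[ℝ] D0 hs hp Ω where
  toFun u := ((show GagliardoTest hs hp Ω from u : GagliardoTest hs hp Ω) : D0 hs hp Ω)
  map_add' u v := UniformSpace.Completion.coe_add (α := GagliardoTest hs hp Ω) u v
  map_smul' c u := UniformSpace.Completion.coe_smul (X := GagliardoTest hs hp Ω) c u

theorem D0.norm_ofTest (u : 𝓓(Ω, ℝ)) : ‖D0.ofTest hs hp Ω u‖ = gagliardo s p u :=
  UniformSpace.Completion.norm_coe (E := GagliardoTest hs hp Ω) u

theorem D0.denseRange_ofTest : DenseRange (D0.ofTest hs hp Ω) :=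
  UniformSpace.Completion.denseRange_coe (α := GagliardoTest hs hp Ω)

end Seminorm

end FracHardy

end

namespace FracHardy

/-! Everything rests on a Hardy inequality with a constant independent of `s` apart from the factor
`1 / (s * (1 - s))`. On the half-line two estimates are combined. The jumps that leave the half-line
give a factor `1 / (s * p)`, good as `s → 0`. For `s > 1 / p`, comparing `g` with its dilations by
Minkowski's inequality gives a factor of order `1 / (1 - s)`, good as `s → 1`. Their combination is
`hardy_halfLine`.

In dimension `N` the energy is written as an integral over increments `t • w`, with `t > 0` and `w`
in the shell `1 < ‖w‖ < 2`. For fixed `w` the space is sliced into lines parallel to `w`, and the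
half-line inequality is applied on each, with the exit time from `K` in place of the distance
(`hardy_direction`). Convexity enters only in `exists_exitTime_le`: a supporting hyperplane at a
nearest boundary point provides a ball of velocities, of fixed radius inside the shell, for which
the exit time is at most `d_K`. Integrating over the shell gives `isHardyConstant_hardyConst`.

Since `d_K ≤ R_K`, Hardy implies Poincaré, hence the eigenvalue bound and a bounded map from the
completion to `L^p(K)`. Its injectivity is a separate closability statement: difference quotients
embed the completion isometrically in an `L^p` space on the product, and their limit is identified
almost everywhere along a subsequence. -/

/-! ### Scaling of integrals and integrals of powers. -/

theorem lintegral_comp_smul {E : Type*} [NormedAddCommGroup E] [NormedSpace ℝ E]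
    [MeasurableSpace E] [BorelSpace E] [FiniteDimensional ℝ E] (μ : Measure E)
    [μ.IsAddHaarMeasure] (F : E → ℝ≥0∞) {t : ℝ} (ht : t ≠ 0) :
    ∫⁻ x, F (t • x) ∂μ = ENNReal.ofReal |(t ^ Module.finrank ℝ E)⁻¹| * ∫⁻ x, F x ∂μ := by
  have h := lintegral_map_equiv (μ := μ) F (Homeomorph.smulOfNeZero t ht).toMeasurableEquiv
  have h2 : Measure.map (Homeomorph.smulOfNeZero t ht : E ≃ₜ E).toMeasurableEquiv μ =
      ENNReal.ofReal |(t ^ Module.finrank ℝ E)⁻¹| • μ := Measure.map_addHaar_smul μ ht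
  rw [h2, lintegral_smul_measure] at h
  exact h.symm

/-- Scaling of integrals over the half-line. -/
theorem lintegral_Ioi_comp_mul (F : ℝ → ℝ≥0∞) {t : ℝ} (ht : 0 < t) :
    ∫⁻ x in Ioi (0 : ℝ), F x = ENNReal.ofReal t * ∫⁻ x in Ioi (0 : ℝ), F (t * x) := by
  have h := lintegral_comp_smul volume ((Ioi (0 : ℝ)).indicator F) ht.ne'
  have h1 : ∀ x, (Ioi (0 : ℝ)).indicator F (t • x) =
      (Ioi (0 : ℝ)).indicator (fun x => F (t * x)) x := by
    intro x
    by_cases hx : 0 < x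
    · simp [indicator, hx, ht]
    · simp [indicator, hx, ht]
  simp_rw [h1] at h
  rw [lintegral_indicator measurableSet_Ioi, lintegral_indicator measurableSet_Ioi] at h
  rw [h, ← mul_assoc, ← ENNReal.ofReal_mul ht.le]
  simp [abs_of_pos ht, ht.ne']

theorem lintegral_Ioi_rpow {q x : ℝ} (hq : 0 < q) (hx : 0 < x) :
    ∫⁻ t in Ioi x, ENNReal.ofReal (t ^ (-1 - q)) = ENNReal.ofReal (x ^ (-q) / q) := by
  rw [← ofReal_integral_eq_lintegral_ofReal (integrableOn_Ioi_rpow_of_lt (by linarith) hx),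
    integral_Ioi_rpow_of_lt (by linarith) hx]
  · congr 1
    rw [show -1 - q + 1 = -q by ring, div_neg, neg_div, neg_neg]
  · filter_upwards [ae_restrict_mem measurableSet_Ioi] with t ht
    have : 0 < t := hx.trans ht
    simp only [Pi.zero_apply]
    positivity

theorem lintegral_Ioo_rpow {r : ℝ} (hr : 0 < r) :
    ∫⁻ t in Ioo (0 : ℝ) 1, ENNReal.ofReal (t ^ (r - 1)) = ENNReal.ofReal (1 / r) := by
  have hi : IntegrableOn (fun t : ℝ => t ^ (r - 1)) (Ioc 0 1) := by
    rw [← intervalIntegrable_iff_integrableOn_Ioc_of_le zero_le_one]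
    exact intervalIntegral.intervalIntegrable_rpow' (by linarith)
  rw [restrict_Ioo_eq_restrict_Ioc, ← ofReal_integral_eq_lintegral_ofReal hi,
    ← intervalIntegral.integral_of_le zero_le_one, integral_rpow (Or.inl (by linarith))]
  · congr 1
    rw [sub_add_cancel, Real.one_rpow, Real.zero_rpow hr.ne', sub_zero]
  · filter_upwards [ae_restrict_mem measurableSet_Ioc] with t ht
    have : 0 < t := ht.1
    simp only [Pi.zero_apply]
    positivity

/-! ### Hardy inequality on the half-line. -/

section HalfLine

variable {g : ℝ → ℝ} {s p : ℝ}

/-- The nonlocal contribution of the complement to the Hardy inequality on the half-line. -/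
theorem hardy_halfLine_exterior (hs : 0 < s) (hp : 0 < p) (hg0 : ∀ x ≤ 0, g x = 0) :
    ENNReal.ofReal (1 / (s * p)) * ∫⁻ x in Ioi (0 : ℝ), ENNReal.ofReal (|g x| ^ p * x ^ (-(s * p)))
      ≤ ∫⁻ x in Ioi (0 : ℝ), ∫⁻ t in Ioi (0 : ℝ),
          ENNReal.ofReal (|g x - g (x - t)| ^ p * t ^ (-1 - s * p)) := by
  have hq : 0 < s * p := by positivity
  rw [← lintegral_const_mul' _ _ ENNReal.ofReal_ne_top]
  refine setLIntegral_mono' measurableSet_Ioi fun x (hx : 0 < x) => ?_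
  -- Only the increments `t > x` are kept: for them `x - t` lies outside the half-line, where `g`
  -- vanishes.
  calc _ = ∫⁻ t in Ioi x, ENNReal.ofReal (|g x| ^ p) * ENNReal.ofReal (t ^ (-1 - s * p)) := by
        rw [lintegral_const_mul' _ _ ENNReal.ofReal_ne_top, lintegral_Ioi_rpow hq hx,
          ← ENNReal.ofReal_mul (by positivity), ← ENNReal.ofReal_mul (by positivity)]
        congr 1
        ring
    _ ≤ ∫⁻ t in Ioi x, ENNReal.ofReal (|g x - g (x - t)| ^ p * t ^ (-1 - s * p)) := by
        refine setLIntegral_mono' measurableSet_Ioi fun t (ht : x < t) => ?_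
        rw [hg0 (x - t) (by linarith), sub_zero, ENNReal.ofReal_mul (by positivity)]
    _ ≤ _ := lintegral_mono_set (Ioi_subset_Ioi hx.le)

/-- Minkowski's inequality compares a function on the half-line with its dilations. -/
theorem dilation_le (hp : 1 < p) (hsp : 1 / p < s) (hs1 : s < 1) (hg : Measurable g)
    (hfin : ∫⁻ x in Ioi (0 : ℝ), ENNReal.ofReal (|g x| ^ p * x ^ (-(s * p))) ≠ ∞)
    {e : ℝ} (he : e ∈ Ioo (0 : ℝ) 1) :
    ENNReal.ofReal (((s - 1 / p) * e) ^ p) *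
        ∫⁻ x in Ioi (0 : ℝ), ENNReal.ofReal (|g x| ^ p * x ^ (-(s * p)))
      ≤ ∫⁻ x in Ioi (0 : ℝ), ENNReal.ofReal (|g x - g (x - e * x)| ^ p * x ^ (-(s * p))) := by
  have hp0 : 0 < p := by linarith
  have hl : 0 < 1 - e := by linarith [he.2]
  have hβ : 0 < s - 1 / p := by linarith
  set l := 1 - e with hl'
  have hpow : ∀ a x : ℝ, 0 < x →
      ENNReal.ofReal (|a| * x ^ (-s)) ^ p = ENNReal.ofReal (|a| ^ p * x ^ (-(s * p))) := by
    intro a x hx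
    rw [ENNReal.ofReal_rpow_of_nonneg (by positivity) hp0.le,
      Real.mul_rpow (abs_nonneg _) (by positivity), ← Real.rpow_mul hx.le, neg_mul]
  have hint : ∀ f : ℝ → ℝ, ∫⁻ x in Ioi (0 : ℝ), ENNReal.ofReal (|f x| * x ^ (-s)) ^ p =
      ∫⁻ x in Ioi (0 : ℝ), ENNReal.ofReal (|f x| ^ p * x ^ (-(s * p))) := fun f =>
    setLIntegral_congr_fun measurableSet_Ioi fun x hx => hpow _ _ hx
  set H := ∫⁻ x in Ioi (0 : ℝ), ENNReal.ofReal (|g x| ^ p * x ^ (-(s * p))) with hH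
  set D := ∫⁻ x in Ioi (0 : ℝ), ENNReal.ofReal (|g x - g (x - e * x)| ^ p * x ^ (-(s * p)))
    with hD
  -- The dilation by `l` multiplies the norm of `L^p(x ^ (-(s * p)) dx)` by `l ^ (s - 1 / p)`, which
  -- is less than `1` exactly because `s > 1 / p`.
  have hdil : ∫⁻ x in Ioi (0 : ℝ), ENNReal.ofReal (|g (l * x)| ^ p * x ^ (-(s * p))) =
      ENNReal.ofReal (l ^ (s * p - 1)) * H := by
    rw [hH, lintegral_Ioi_comp_mul (fun x => ENNReal.ofReal (|g x| ^ p * x ^ (-(s * p)))) hl,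
      ← mul_assoc, ← ENNReal.ofReal_mul (by positivity),
      ← lintegral_const_mul' _ _ ENNReal.ofReal_ne_top]
    refine setLIntegral_congr_fun measurableSet_Ioi fun x (hx : 0 < x) => ?_
    rw [← ENNReal.ofReal_mul (by positivity), Real.mul_rpow hl.le hx.le]
    congr 1
    have : l ^ (s * p - 1) * l * l ^ (-(s * p)) = 1 := by
      rw [← Real.rpow_add_one hl.ne', ← Real.rpow_add hl]; simp
    linear_combination -(|g (l * x)| ^ p * x ^ (-(s * p))) * this
  have hmink : H ^ (1 / p) ≤ D ^ (1 / p) + ENNReal.ofReal (l ^ (s - 1 / p)) * H ^ (1 / p) := by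
    have h1 : H ≤ ∫⁻ x in Ioi (0 : ℝ),
        ((fun x => ENNReal.ofReal (|g x - g (x - e * x)| * x ^ (-s))) +
          fun x => ENNReal.ofReal (|g (l * x)| * x ^ (-s))) x ^ p := by
      rw [hH, ← hint]
      refine setLIntegral_mono' measurableSet_Ioi fun x (hx : 0 < x) => ?_
      gcongr
      rw [Pi.add_apply, ← ENNReal.ofReal_add (by positivity) (by positivity), ← add_mul]
      gcongr
      rw [show x - e * x = l * x by rw [hl']; ring]
      simpa using abs_add_le (g x - g (l * x)) (g (l * x))
    refine (ENNReal.rpow_le_rpow h1 (by positivity)).trans ?_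
    refine (ENNReal.lintegral_Lp_add_le (by fun_prop) (by fun_prop) hp.le).trans_eq ?_
    rw [hint, hint (fun x => g (l * x)), hdil, ENNReal.mul_rpow_of_nonneg _ _ (by positivity),
      ENNReal.ofReal_rpow_of_nonneg (by positivity) (by positivity), ← Real.rpow_mul hl.le]
    congr 4
    field_simp
  have hHp : H ^ (1 / p) ≠ ∞ := ENNReal.rpow_ne_top_of_nonneg (by positivity) hfin
  -- Bernoulli's inequality for an exponent between `0` and `1` makes the gap `1 - l ^ (s - 1 / p)`
  -- at least linear in `e`.
  have hbern : l ^ (s - 1 / p) ≤ 1 - (s - 1 / p) * e := by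
    have hp1 : 0 < 1 / p := by positivity
    have := rpow_one_add_le_one_add_mul_self (s := -e) (by linarith [he.2]) hβ.le
      (by linarith)
    rw [hl', sub_eq_add_neg]
    linarith
  have hroot : ENNReal.ofReal ((s - 1 / p) * e) * H ^ (1 / p) ≤ D ^ (1 / p) := by
    have hle1 : (s - 1 / p) * e ≤ 1 := by
      have : 0 ≤ l ^ (s - 1 / p) := by positivity
      linarith
    have h2 : ENNReal.ofReal (l ^ (s - 1 / p)) * H ^ (1 / p) +
        ENNReal.ofReal ((s - 1 / p) * e) * H ^ (1 / p) ≤ H ^ (1 / p) := by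
      rw [← add_mul, ← ENNReal.ofReal_add (by positivity) (by have := he.1; positivity)]
      refine (mul_le_mul_left (ENNReal.ofReal_le_one.2 (by linarith)) _).trans_eq (one_mul _)
    have h3 := h2.trans hmink
    rw [add_comm (D ^ (1 / p))] at h3
    -- The finiteness of `H` is what allows the dilated term to be cancelled.
    exact (ENNReal.add_le_add_iff_left (ENNReal.mul_ne_top ENNReal.ofReal_ne_top hHp)).1 h3
  have := ENNReal.rpow_le_rpow hroot hp0.le
  rwa [ENNReal.mul_rpow_of_nonneg _ _ hp0.le, ← ENNReal.rpow_mul, ← ENNReal.rpow_mul,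
    one_div, inv_mul_cancel₀ hp0.ne', ENNReal.rpow_one, ENNReal.rpow_one,
    ENNReal.ofReal_rpow_of_nonneg (by rw [← one_div]; have := he.1; positivity) hp0.le,
    ← one_div] at this

/-- The local part of the Hardy inequality on the half-line, for `s p > 1`. -/
theorem hardy_halfLine_interior (hp : 1 < p) (hsp : 1 / p < s) (hs1 : s < 1) (hg : Measurable g)
    (hfin : ∫⁻ x in Ioi (0 : ℝ), ENNReal.ofReal (|g x| ^ p * x ^ (-(s * p))) ≠ ∞) :
    ENNReal.ofReal ((s - 1 / p) ^ p / (p * (1 - s))) *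
        ∫⁻ x in Ioi (0 : ℝ), ENNReal.ofReal (|g x| ^ p * x ^ (-(s * p)))
      ≤ ∫⁻ x in Ioi (0 : ℝ), ∫⁻ t in Ioi (0 : ℝ),
          ENNReal.ofReal (|g x - g (x - t)| ^ p * t ^ (-1 - s * p)) := by
  have hp0 : 0 < p := by linarith
  have hβ : 0 < s - 1 / p := by linarith
  set H := ∫⁻ x in Ioi (0 : ℝ), ENNReal.ofReal (|g x| ^ p * x ^ (-(s * p))) with hH
  -- With `t = e * x`, the factor `e ^ p` from `dilation_le` meets the kernel `e ^ (-1 - s * p)`;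
  -- the product is integrable at `0`, and its integral over `(0, 1)` is `1 / (p * (1 - s))`.
  calc ENNReal.ofReal ((s - 1 / p) ^ p / (p * (1 - s))) * H
      = ∫⁻ e in Ioo (0 : ℝ) 1, ENNReal.ofReal (e ^ (p * (1 - s) - 1)) *
          (ENNReal.ofReal ((s - 1 / p) ^ p) * H) := by
        rw [lintegral_mul_const _ (by fun_prop),
          lintegral_Ioo_rpow (mul_pos hp0 (by linarith)), ← mul_assoc,
          ← ENNReal.ofReal_mul (by have := sub_pos.2 hs1; positivity)]
        congr 2
        ring
    _ ≤ ∫⁻ e in Ioo (0 : ℝ) 1, ∫⁻ x in Ioi (0 : ℝ), ENNReal.ofReal (e ^ (-1 - s * p)) *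
          ENNReal.ofReal (|g x - g (x - e * x)| ^ p * x ^ (-(s * p))) := by
        refine setLIntegral_mono' measurableSet_Ioo fun e he => ?_
        have he0 := he.1
        rw [lintegral_const_mul' _ _ ENNReal.ofReal_ne_top]
        refine le_trans (le_of_eq ?_) (mul_le_mul_right (dilation_le hp hsp hs1 hg hfin he) _)
        have hexp : e ^ (p * (1 - s) - 1) = e ^ (-1 - s * p) * e ^ p := by
          rw [← Real.rpow_add he0]
          ring_nf
        rw [← hH, ← mul_assoc, ← mul_assoc, ← ENNReal.ofReal_mul (by positivity),
          ← ENNReal.ofReal_mul (by positivity), Real.mul_rpow hβ.le he0.le, hexp]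
        congr 2
        ring
    _ = ∫⁻ x in Ioi (0 : ℝ), ∫⁻ e in Ioo (0 : ℝ) 1, ENNReal.ofReal (e ^ (-1 - s * p)) *
          ENNReal.ofReal (|g x - g (x - e * x)| ^ p * x ^ (-(s * p))) :=
        lintegral_lintegral_swap (by fun_prop)
    _ ≤ _ := by
        refine setLIntegral_mono' measurableSet_Ioi fun x (hx : 0 < x) => ?_
        rw [lintegral_Ioi_comp_mul _ hx, ← lintegral_const_mul' _ _ ENNReal.ofReal_ne_top]
        refine le_trans (setLIntegral_mono' measurableSet_Ioo fun e he => ?_)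
          (lintegral_mono_set Ioo_subset_Ioi_self)
        have he0 := he.1
        rw [← ENNReal.ofReal_mul (by positivity), ← ENNReal.ofReal_mul (by positivity),
          Real.mul_rpow hx.le he0.le]
        refine ENNReal.ofReal_le_ofReal (le_of_eq ?_)
        have : x * x ^ (-1 - s * p) = x ^ (-(s * p)) := by
          rw [← Real.rpow_one_add' hx.le (by have := (div_lt_iff₀ hp0).1 hsp; linarith)]
          congr 1; ring
        rw [← this, mul_comm e x]
        ring

/-- The constant of the one-dimensional Hardy inequality. -/
noncomputable def lineConst (p : ℝ) : ℝ := min 1 (((1 - 1 / p) / 2) ^ p) * ((1 - 1 / p) / 2) / p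

theorem lineConst_pos (hp : 1 < p) : 0 < lineConst p := by
  have hp0 : 0 < p := by linarith
  have : 0 < 1 - 1 / p := by rw [sub_pos, div_lt_one hp0]; exact hp
  unfold lineConst
  have : 0 < min 1 (((1 - 1 / p) / 2) ^ p) := lt_min one_pos (by positivity)
  positivity

/-- The fractional Hardy inequality on the half-line, with the right behaviour of the constant
as `s → 0` and `s → 1`. -/
theorem hardy_halfLine (hp : 1 < p) (hs : s ∈ Ioo (0 : ℝ) 1) (hg : Measurable g)
    (hg0 : ∀ x ≤ 0, g x = 0)
    (hfin : ∫⁻ x in Ioi (0 : ℝ), ENNReal.ofReal (|g x| ^ p * x ^ (-(s * p))) ≠ ∞) :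
    ENNReal.ofReal (lineConst p / (s * (1 - s))) *
        ∫⁻ x in Ioi (0 : ℝ), ENNReal.ofReal (|g x| ^ p * x ^ (-(s * p)))
      ≤ ∫⁻ x in Ioi (0 : ℝ), ∫⁻ t in Ioi (0 : ℝ),
          ENNReal.ofReal (|g x - g (x - t)| ^ p * t ^ (-1 - s * p)) := by
  have hp0 : 0 < p := by linarith
  obtain ⟨hs0, hs1⟩ := hs
  have hs1' := sub_pos.2 hs1
  set β := (1 - 1 / p) / 2 with hβ
  have hβ0 : 0 < β := by
    have : 0 < 1 - 1 / p := by rw [sub_pos, div_lt_one hp0]; exact hp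
    positivity
  have hp1 : 0 < 1 / p := by positivity
  have hm0 : 0 ≤ min 1 (β ^ p) := le_min zero_le_one (by positivity)
  -- If `1 - s < β`, then `s - 1 / p > β` and `s > β`, so the interior estimate has a uniform
  -- constant. Otherwise `1 - s` is bounded below and the exterior estimate suffices.
  rcases lt_or_ge (1 - s) β with h | h
  · refine le_trans (mul_le_mul_left (ENNReal.ofReal_le_ofReal ?_) _)
      (hardy_halfLine_interior hp (by linarith) hs1 hg hfin)
    have h1 : min 1 (β ^ p) ≤ (s - 1 / p) ^ p :=
      (min_le_right _ _).trans (Real.rpow_le_rpow hβ0.le (by linarith) hp0.le)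
    calc lineConst p / (s * (1 - s)) = min 1 (β ^ p) * (β / s) / (p * (1 - s)) := by
          unfold lineConst; rw [← hβ]; field_simp
      _ ≤ (s - 1 / p) ^ p * 1 / (p * (1 - s)) := by
          have : β / s ≤ 1 := by rw [div_le_one hs0]; linarith
          gcongr
          exact hm0.trans h1
      _ = _ := by rw [mul_one]
  · refine le_trans (mul_le_mul_left (ENNReal.ofReal_le_ofReal ?_) _)
      (hardy_halfLine_exterior hs0 hp0 hg0)
    calc lineConst p / (s * (1 - s)) = min 1 (β ^ p) * (β / (1 - s)) / (s * p) := by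
          unfold lineConst; rw [← hβ]; field_simp
      _ ≤ 1 * 1 / (s * p) := by
          have : β / (1 - s) ≤ 1 := by rwa [div_le_one hs1']
          gcongr
          exact min_le_left _ _
      _ = _ := by rw [mul_one]

end HalfLine

/-! ### Integration over shells and along lines. -/

/-- Integration in polar coordinates, with the sphere replaced by the shell `1 < |w| < 2`. -/
theorem lintegral_shell {N : ℕ} (hN : 1 ≤ N) {F : Eucl N → ℝ≥0∞} (hF : Measurable F) :
    ∫⁻ w in {w : Eucl N | 1 < ‖w‖ ∧ ‖w‖ < 2}, ∫⁻ t in Ioi (0 : ℝ),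
        ENNReal.ofReal (t ^ ((N : ℝ) - 1)) * F (t • w)
      = ENNReal.ofReal (Real.log 2) * ∫⁻ h, F h := by
  have hA : MeasurableSet {w : Eucl N | 1 < ‖w‖ ∧ ‖w‖ < 2} :=
    (measurableSet_lt measurable_const measurable_norm).inter
      (measurableSet_lt measurable_norm measurable_const)
  set A : Set (Eucl N) := {w : Eucl N | 1 < ‖w‖ ∧ ‖w‖ < 2} with hAdef
  have hind : Measurable (A.indicator (1 : Eucl N → ℝ≥0∞)) := measurable_one.indicator hA
  have : Nonempty (Fin N) := ⟨⟨0, hN⟩⟩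
  calc _ = ∫⁻ t in Ioi (0 : ℝ), ∫⁻ w in A, ENNReal.ofReal (t ^ ((N : ℝ) - 1)) * F (t • w) :=
        lintegral_lintegral_swap (by fun_prop)
    -- Substituting `h = t • w` costs `t ^ (-N)`, leaving `t⁻¹`. For fixed `h ≠ 0`, the times with
    -- `t⁻¹ • h` in the shell form `(‖h‖ / 2, ‖h‖)`, on which `t⁻¹` has integral `log 2`.
    _ = ∫⁻ t in Ioi (0 : ℝ), ∫⁻ h, ENNReal.ofReal t⁻¹ * (A.indicator 1 (t⁻¹ • h) * F h) := by
        refine setLIntegral_congr_fun measurableSet_Ioi fun t (ht : 0 < t) => ?_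
        have h1 := lintegral_comp_smul volume (fun h => A.indicator 1 (t⁻¹ • h) * F h) ht.ne'
        rw [lintegral_const_mul' _ _ ENNReal.ofReal_ne_top,
          lintegral_const_mul' _ _ ENNReal.ofReal_ne_top, ← lintegral_indicator hA]
        have h2 : ∀ w, A.indicator (fun w => F (t • w)) w =
            A.indicator 1 (t⁻¹ • (t • w)) * F (t • w) := by
          intro w
          rw [inv_smul_smul₀ ht.ne']
          by_cases hw : w ∈ A <;> simp [hw]
        simp_rw [h2]
        rw [h1, ← mul_assoc, ← ENNReal.ofReal_mul (by positivity)]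
        congr 2
        rw [finrank_euclideanSpace_fin, abs_of_pos (by positivity), Real.rpow_sub ht,
          Real.rpow_natCast, Real.rpow_one]
        field_simp
    _ = ∫⁻ h, ∫⁻ t in Ioi (0 : ℝ), ENNReal.ofReal t⁻¹ * (A.indicator 1 (t⁻¹ • h) * F h) :=
        lintegral_lintegral_swap (by fun_prop)
    _ = ∫⁻ h, ENNReal.ofReal (Real.log 2) * F h := by
        refine lintegral_congr_ae ?_
        have h0 : ∀ᵐ h : Eucl N, h ≠ 0 := by
          simp [ae_iff]
        filter_upwards [h0] with h hh
        have hpos : 0 < ‖h‖ := norm_pos_iff.2 hh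
        simp_rw [← mul_assoc]
        rw [lintegral_mul_const _ (by fun_prop)]
        congr 1
        have h2 : ∀ t ∈ Ioi (0 : ℝ), ENNReal.ofReal t⁻¹ * A.indicator 1 (t⁻¹ • h) =
            (Ioo (‖h‖ / 2) ‖h‖).indicator (fun t => ENNReal.ofReal t⁻¹) t := by
          intro t (ht : 0 < t)
          have : t⁻¹ • h ∈ A ↔ t ∈ Ioo (‖h‖ / 2) ‖h‖ := by
            rw [hAdef, mem_ofPred_eq, norm_smul, Real.norm_of_nonneg (by positivity),
              ← div_eq_inv_mul, one_lt_div ht, div_lt_iff₀ ht, mem_Ioo, div_lt_iff₀ two_pos,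
              and_comm, mul_comm]
          by_cases ht' : t ∈ Ioo (‖h‖ / 2) ‖h‖
          · simp [this.2 ht', ht']
          · simp [mt this.1 ht', ht']
        rw [setLIntegral_congr_fun measurableSet_Ioi h2, lintegral_indicator measurableSet_Ioo,
          Measure.restrict_restrict measurableSet_Ioo, inter_eq_left.2 (fun t ht =>
            (by have := ht.1; simp only [mem_Ioi]; linarith [half_pos hpos])),
          restrict_Ioo_eq_restrict_Ioc]
        have hle : ‖h‖ / 2 ≤ ‖h‖ := by linarith
        have hi : IntervalIntegrable (fun t : ℝ => t⁻¹) volume (‖h‖ / 2) ‖h‖ :=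
          intervalIntegrable_inv_iff.2 (Or.inr fun h0 => by
            rw [uIcc_of_le hle] at h0; linarith [h0.1])
        rw [← ofReal_integral_eq_lintegral_ofReal
            ((intervalIntegrable_iff_integrableOn_Ioc_of_le hle).1 hi),
          ← intervalIntegral.integral_of_le hle, integral_inv_of_pos (by positivity) hpos]
        · congr 2
          field_simp
        · filter_upwards [ae_restrict_mem measurableSet_Ioc] with t ht
          have : 0 < t := lt_trans (half_pos hpos) ht.1
          simp only [Pi.zero_apply]
          positivity
    _ = _ := lintegral_const_mul' _ _ ENNReal.ofReal_ne_top

/-- Integration along the lines of direction `w`: the integral over the space is the integral over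
a slab transversal to `w` of the integrals over the lines. -/
theorem lintegral_lines {N : ℕ} {w : Eucl N} (hw : w ≠ 0) {F : Eucl N → ℝ≥0∞}
    (hF : Measurable F) :
    ∫⁻ x, F x = ∫⁻ x in {x : Eucl N | 0 ≤ inner ℝ x w ∧ inner ℝ x w < ‖w‖ ^ 2},
      ∫⁻ τ : ℝ, F (x + τ • w) := by
  have hS : MeasurableSet {x : Eucl N | 0 ≤ inner ℝ x w ∧ inner ℝ x w < ‖w‖ ^ 2} :=
    (measurableSet_le (f := fun _ => (0 : ℝ)) (g := fun x : Eucl N => inner ℝ x w)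
      measurable_const (by fun_prop)).inter
      (measurableSet_lt (f := fun x : Eucl N => inner ℝ x w) (g := fun _ => ‖w‖ ^ 2)
        (by fun_prop) measurable_const)
  set S : Set (Eucl N) := {x : Eucl N | 0 ≤ inner ℝ x w ∧ inner ℝ x w < ‖w‖ ^ 2} with hSdef
  have hind : Measurable (S.indicator (1 : Eucl N → ℝ≥0∞)) := measurable_one.indicator hS
  have hw2 : 0 < ‖w‖ ^ 2 := by positivity
  -- Every line of direction `w` spends exactly one unit of time in the slab. Inserting this factor
  -- `1` under the integral, exchanging integrals and translating gives the formula.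
  have hone : ∀ x : Eucl N, ∫⁻ τ : ℝ, S.indicator (1 : Eucl N → ℝ≥0∞) (x - τ • w) = 1 := by
    intro x
    have h1 : ∀ τ : ℝ, S.indicator (1 : Eucl N → ℝ≥0∞) (x - τ • w) =
        (Ioc (inner ℝ x w / ‖w‖ ^ 2 - 1) (inner ℝ x w / ‖w‖ ^ 2)).indicator 1 τ := by
      intro τ
      have : x - τ • w ∈ S ↔ τ ∈ Ioc (inner ℝ x w / ‖w‖ ^ 2 - 1) (inner ℝ x w / ‖w‖ ^ 2) := by
        rw [hSdef, mem_ofPred_eq, inner_sub_left, real_inner_smul_left,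
          real_inner_self_eq_norm_sq, mem_Ioc, le_div_iff₀ hw2, sub_lt_iff_lt_add
          (a := inner ℝ x w / ‖w‖ ^ 2), div_lt_iff₀ hw2]
        constructor <;> rintro ⟨h1, h2⟩ <;> constructor <;> linarith
      by_cases hτ : τ ∈ Ioc (inner ℝ x w / ‖w‖ ^ 2 - 1) (inner ℝ x w / ‖w‖ ^ 2)
      · simp only [indicator, this.2 hτ, hτ, Pi.one_apply, if_true]
      · simp only [indicator, mt this.1 hτ, hτ, if_false]
    simp_rw [h1]
    rw [lintegral_indicator_one measurableSet_Ioc, Real.volume_Ioc]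
    simp
  calc ∫⁻ x, F x = ∫⁻ x, ∫⁻ τ : ℝ, S.indicator (1 : Eucl N → ℝ≥0∞) (x - τ • w) * F x := by
        refine lintegral_congr fun x => ?_
        rw [lintegral_mul_const _ (by fun_prop), hone, one_mul]
    _ = ∫⁻ τ : ℝ, ∫⁻ x, S.indicator (1 : Eucl N → ℝ≥0∞) (x - τ • w) * F x :=
        lintegral_lintegral_swap (by fun_prop)
    _ = ∫⁻ τ : ℝ, ∫⁻ x, S.indicator (1 : Eucl N → ℝ≥0∞) x * F (x + τ • w) := by
        refine lintegral_congr fun τ => ?_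
        rw [← lintegral_add_right_eq_self _ (τ • w)]
        simp_rw [add_sub_cancel_right]
    _ = ∫⁻ x, ∫⁻ τ : ℝ, S.indicator (1 : Eucl N → ℝ≥0∞) x * F (x + τ • w) :=
        lintegral_lintegral_swap (by fun_prop)
    _ = _ := by
        rw [← lintegral_indicator hS]
        refine lintegral_congr fun x => ?_
        rw [lintegral_const_mul _ (by fun_prop)]
        by_cases hx : x ∈ S <;> simp [hx]

/-! ### Exit times and supporting hyperplanes. -/

/-- The time after which a point moving from `x` with velocity `w` has left `Ω` for ever. -/
noncomputable def exitTime {N : ℕ} (Ω : Opens (Eucl N)) (x w : Eucl N) : ℝ≥0∞ :=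
  ⨆ t : ℝ, {z : Eucl N × Eucl N | z.1 + t • z.2 ∈ Ω}.indicator
    (fun _ => ENNReal.ofReal t) (x, w)

/-- The supremum runs over uncountably many `t`, so measurability comes from lower semicontinuity:
each indicator is that of an open set, with a nonnegative value. -/
theorem measurable_exitTime {N : ℕ} (Ω : Opens (Eucl N)) :
    Measurable fun z : Eucl N × Eucl N => exitTime Ω z.1 z.2 := by
  refine LowerSemicontinuous.measurable ?_
  refine lowerSemicontinuous_iSup fun t => ?_
  exact (Ω.isOpen.preimage (by fun_prop : Continuous fun z : Eucl N × Eucl N =>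
    z.1 + t • z.2)).lowerSemicontinuous_indicator zero_le

theorem measurable_exitTime_left {N : ℕ} (Ω : Opens (Eucl N)) (w : Eucl N) :
    Measurable fun x => exitTime Ω x w :=
  Measurable.of_uncurry_right (f := exitTime Ω) (measurable_exitTime Ω)

theorem le_exitTime {N : ℕ} {Ω : Opens (Eucl N)} {x w : Eucl N} {t : ℝ} (h : x + t • w ∈ Ω) :
    ENNReal.ofReal t ≤ exitTime Ω x w := by
  refine le_trans (le_of_eq ?_) (le_iSup _ t)
  rw [indicator_of_mem (by exact h)]

theorem exitTime_le {N : ℕ} {Ω : Opens (Eucl N)} {x w : Eucl N} {r : ℝ≥0∞}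
    (h : ∀ t : ℝ, x + t • w ∈ Ω → ENNReal.ofReal t ≤ r) : exitTime Ω x w ≤ r := by
  refine iSup_le fun t => ?_
  by_cases ht : x + t • w ∈ Ω
  · rw [indicator_of_mem (by exact ht)]
    exact h t ht
  · rw [indicator_of_notMem (by exact ht)]
    exact zero_le

/-- In a convex set, a point that moves at speed at least one along the outward normal of a
supporting hyperplane leaves before time the distance to the boundary; the set of such velocities
has a measure that does not depend on the hyperplane. -/
theorem exists_exitTime_le {N : ℕ} {K : Opens (Eucl N)} (hK : Convex ℝ (K : Set (Eucl N)))
    (hne : (K : Set (Eucl N)) ≠ univ) {x : Eucl N} (hx : x ∈ K) :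
    ∃ c : Eucl N, Metric.ball c (1 / 2) ⊆ {w : Eucl N | 1 < ‖w‖ ∧ ‖w‖ < 2} ∧
      ∀ w ∈ Metric.ball c (1 / 2), exitTime K x w ≤ bdryDist K x := by
  have hfr : (frontier (K : Set (Eucl N))).Nonempty :=
    nonempty_frontier_iff.2 ⟨⟨x, hx⟩, hne⟩
  obtain ⟨x₀, hx₀, hd⟩ := isClosed_frontier.exists_infDist_eq_dist hfr x
  have hx₀K : x₀ ∉ (K : Set (Eucl N)) := by
    rw [K.isOpen.frontier_eq] at hx₀
    exact hx₀.2
  obtain ⟨f, hf⟩ := geometric_hahn_banach_open_point hK K.isOpen hx₀K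
  set v : Eucl N := (InnerProductSpace.toDual ℝ (Eucl N)).symm f with hv
  have hfv : ∀ y, inner ℝ v y = f y := fun y => InnerProductSpace.toDual_symm_apply
  have hv0 : v ≠ 0 := by
    rintro h
    have := hf x hx
    rw [← hfv, ← hfv, h] at this
    simp at this
  have hvn : 0 < ‖v‖ := norm_pos_iff.2 hv0
  set n : Eucl N := ‖v‖⁻¹ • v with hn
  have hnn : ‖n‖ = 1 := by
    rw [hn, norm_smul, norm_inv, norm_norm, inv_mul_cancel₀ hvn.ne']
  have hK' : ∀ y ∈ K, inner ℝ n (y - x₀) < 0 := by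
    intro y hy
    have h1 := hf y hy
    rw [← hfv, ← hfv] at h1
    rw [hn, real_inner_smul_left, inner_sub_right]
    exact mul_neg_of_pos_of_neg (inv_pos.2 hvn) (by linarith)
  have hnorm : ‖(3 / 2 : ℝ) • n‖ = 3 / 2 := by
    rw [norm_smul, hnn]; norm_num
  -- The ball of radius `1 / 2` about `(3 / 2) • n` fits in the shell, and each of its velocities
  -- has component at least `3 / 2 - 1 / 2 = 1` along `n`.
  refine ⟨(3 / 2 : ℝ) • n, ?_, ?_⟩
  · intro w hw
    rw [mem_ball_iff_norm] at hw
    have h1 := norm_sub_norm_le w ((3 / 2 : ℝ) • n)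
    have h2 := norm_sub_norm_le ((3 / 2 : ℝ) • n) w
    rw [norm_sub_rev] at h2
    constructor <;> linarith
  · intro w hw
    rw [mem_ball_iff_norm] at hw
    have hwn : 1 ≤ inner ℝ n w := by
      have h1 : inner ℝ n w = 3 / 2 + inner ℝ n (w - (3 / 2 : ℝ) • n) := by
        rw [inner_sub_right, real_inner_smul_right, real_inner_self_eq_norm_sq, hnn]; ring
      have h2 := abs_real_inner_le_norm n (w - (3 / 2 : ℝ) • n)
      rw [hnn, one_mul] at h2
      linarith [(abs_le.1 h2).1]
    refine exitTime_le fun t ht => ?_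
    have hdist : bdryDist K x = ENNReal.ofReal (dist x x₀) := by
      rw [← hd, Metric.infDist, ENNReal.ofReal_toReal (Metric.infEDist_ne_top hfr), bdryDist]
    rw [hdist]
    refine ENNReal.ofReal_le_ofReal ?_
    rcases le_or_gt t 0 with h0 | h0
    · exact h0.trans dist_nonneg
    -- As long as the moving point is in `K`, it has not crossed the hyperplane, so `t ≤ t * ⟪n, w⟫
    -- < ⟪n, x₀ - x⟫ ≤ dist x x₀`.
    have h1 := hK' _ ht
    rw [show x + t • w - x₀ = t • w - (x₀ - x) by abel, inner_sub_right,
      real_inner_smul_right] at h1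
    have h2 := (le_abs_self _).trans (abs_real_inner_le_norm n (x₀ - x))
    rw [hnn, one_mul, ← dist_eq_norm, dist_comm] at h2
    nlinarith

/-! ### Hardy inequality on lines, in a direction, and on convex sets. -/

variable {N : ℕ} {s p : ℝ}

/-- Times in `Ω` come arbitrarily close to the supremum `b`, so starting at parameter `b - y` the
exit time is at least `y`. The section of `Ω` by the line need not be an interval. -/
theorem le_exitTime_line {Ω : Opens (Eucl N)} {x w : Eucl N} {b y : ℝ}
    (hb : IsLUB {τ : ℝ | x + τ • w ∈ Ω} b) :
    ENNReal.ofReal y ≤ exitTime Ω (x + (b - y) • w) w := by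
  refine le_of_forall_lt fun a ha => ?_
  have hat : a ≠ ∞ := ha.ne_top
  rw [← ENNReal.ofReal_toReal hat] at ha ⊢
  have hay : a.toReal < y := (ENNReal.ofReal_lt_ofReal_iff'.1 ha).1
  obtain ⟨τ, hτ, hlt, -⟩ := hb.exists_between (show b - (y - a.toReal) < b by linarith)
  have h1 : x + (b - y) • w + (τ - (b - y)) • w ∈ Ω := by
    rw [add_assoc, ← add_smul, add_sub_cancel]
    exact hτ
  refine lt_of_lt_of_le ?_ (le_exitTime h1)
  have h0 : 0 ≤ a.toReal := ENNReal.toReal_nonneg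
  exact (ENNReal.ofReal_lt_ofReal_iff (by linarith)).2 (by linarith)

/-- The Hardy inequality along a line. -/
theorem hardy_line (hs : s ∈ Ioo (0 : ℝ) 1) (hp : 1 < p) {K : Opens (Eucl N)} (u : 𝓓(K, ℝ))
    (x : Eucl N) {w : Eucl N} (hw : w ≠ 0) :
    ENNReal.ofReal (lineConst p / (s * (1 - s))) *
        ∫⁻ τ : ℝ, ENNReal.ofReal (|u (x + τ • w)| ^ p) / exitTime K (x + τ • w) w ^ (s * p)
      ≤ ∫⁻ τ : ℝ, ∫⁻ t in Ioi (0 : ℝ),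
          ENNReal.ofReal (|u (x + τ • w + t • w) - u (x + τ • w)| ^ p * t ^ (-1 - s * p)) := by
  have hp0 : 0 < p := by linarith
  have hq : 0 < s * p := mul_pos hs.1 hp0
  have hu0 : ∀ y, y ∉ K → u y = 0 := fun y hy =>
    image_eq_zero_of_notMem_tsupport fun h => hy (u.tsupport_subset h)
  set I : Set ℝ := {τ : ℝ | x + τ • w ∈ K} with hI
  have hIo : IsOpen I := K.isOpen.preimage (by fun_prop : Continuous fun τ : ℝ => x + τ • w)
  by_cases hne : I.Nonempty
  swap
  · have h0 : ∀ τ : ℝ, u (x + τ • w) = 0 := fun τ => hu0 _ fun h => hne ⟨τ, h⟩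
    simp [h0, Real.zero_rpow hp0.ne']
  -- On a line that never leaves `K` for good the exit time is `∞`, and the weighted left-hand side
  -- is zero.
  by_cases hbdd : BddAbove I
  swap
  · have h0 : ∀ τ : ℝ, exitTime K (x + τ • w) w = ∞ := by
      intro τ
      refine ENNReal.eq_top_of_forall_nnreal_le fun r => ?_
      obtain ⟨a, ha, hlt⟩ := not_bddAbove_iff.1 hbdd (τ + r)
      have h1 : x + τ • w + (a - τ) • w ∈ K := by
        rw [add_assoc, ← add_smul, add_sub_cancel]
        exact ha
      refine le_trans ?_ (le_exitTime h1)
      rw [← ENNReal.ofReal_coe_nnreal]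
      exact ENNReal.ofReal_le_ofReal (by linarith)
    simp [h0, ENNReal.top_rpow_of_pos hq]
  have hlub := isLUB_csSup hne hbdd
  set b := sSup I with hb
  have hIb : ∀ τ ∈ I, τ < b := by
    intro τ hτ
    obtain ⟨τ', h1, h2⟩ := (show ∀ᶠ a in nhds τ, a ∈ I from hIo.mem_nhds hτ).exists_gt
    exact lt_of_lt_of_le h1 (hlub.1 h2)
  have hb0 : ∀ τ, b ≤ τ → u (x + τ • w) = 0 :=
    fun τ hτ => hu0 _ fun h => (hIb τ h).not_ge hτ
  -- The line is run backwards from the last exit, so that `y` is the time left before it and `g`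
  -- vanishes for `y ≤ 0`.
  set g : ℝ → ℝ := fun y => u (x + (b - y) • w) with hg
  have hgc : Continuous g := u.continuous.comp (by fun_prop)
  have hg0 : ∀ y ≤ 0, g y = 0 := fun y hy => hb0 _ (by linarith)
  -- The support of `u` meets the line in a compact set of parameters that stays away from `y = 0`,
  -- where the weight is singular.
  have hfin : ∫⁻ y in Ioi (0 : ℝ), ENNReal.ofReal (|g y| ^ p * y ^ (-(s * p))) ≠ ∞ := by
    set T : Set ℝ := (fun y : ℝ => x + (b - y) • w) ⁻¹' tsupport u with hT
    have hemb : Topology.IsClosedEmbedding fun y : ℝ => x + (b - y) • w :=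
      ((Homeomorph.addLeft x).isClosedEmbedding.comp (isClosedEmbedding_smul_left hw)).comp
        (Homeomorph.subLeft b).isClosedEmbedding
    have hTc : IsCompact T := hemb.isCompact_preimage u.hasCompactSupport
    have hTpos : ∀ y ∈ T, 0 < y := by
      intro y hy
      have := hIb (b - y) (u.tsupport_subset hy)
      linarith
    have hint : IntegrableOn (fun y => |g y| ^ p * y ^ (-(s * p))) T := by
      refine ContinuousOn.integrableOn_compact hTc ?_
      refine (hgc.abs.rpow_const fun _ => Or.inr hp0.le).continuousOn.mul ?_
      exact continuousOn_id.rpow_const fun y hy => Or.inl (hTpos y hy).ne'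
    have hfinT := hint.2
    rw [hasFiniteIntegral_iff_ofReal] at hfinT
    · refine (lt_of_le_of_lt ?_ hfinT).ne
      rw [← lintegral_indicator hTc.measurableSet]
      refine le_trans (lintegral_mono fun y => ?_) (setLIntegral_le_lintegral (Ioi 0) _)
      by_cases hy : y ∈ T
      · simp [hy]
      · have : g y = 0 := image_eq_zero_of_notMem_tsupport (f := u) hy
        simp [this, Real.zero_rpow hp0.ne']
    · filter_upwards [ae_restrict_mem hTc.measurableSet] with y hy
      have := hTpos y hy
      simp only [Pi.zero_apply]
      positivity
  calc _ = ENNReal.ofReal (lineConst p / (s * (1 - s))) *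
        ∫⁻ y : ℝ, ENNReal.ofReal (|g y| ^ p) / exitTime K (x + (b - y) • w) w ^ (s * p) := by
        rw [← lintegral_sub_left_eq_self _ b]
    _ ≤ ENNReal.ofReal (lineConst p / (s * (1 - s))) *
          ∫⁻ y in Ioi (0 : ℝ), ENNReal.ofReal (|g y| ^ p * y ^ (-(s * p))) := by
        refine mul_le_mul_right ?_ _
        rw [← lintegral_indicator measurableSet_Ioi]
        refine lintegral_mono fun y => ?_
        rcases le_or_gt y 0 with hy | hy
        · simp [hg0 y hy, Real.zero_rpow hp0.ne']
        · rw [indicator_of_mem (by exact hy), ENNReal.ofReal_mul (by positivity),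
            Real.rpow_neg hy.le, ENNReal.ofReal_inv_of_pos (by positivity),
            ← ENNReal.ofReal_rpow_of_pos hy, div_eq_mul_inv]
          gcongr
          exact le_exitTime_line hlub
    _ ≤ ∫⁻ y in Ioi (0 : ℝ), ∫⁻ t in Ioi (0 : ℝ),
          ENNReal.ofReal (|g y - g (y - t)| ^ p * t ^ (-1 - s * p)) :=
        hardy_halfLine hp hs hgc.measurable hg0 hfin
    _ ≤ ∫⁻ y : ℝ, ∫⁻ t in Ioi (0 : ℝ),
          ENNReal.ofReal (|u (x + (b - y) • w + t • w) - u (x + (b - y) • w)| ^ p *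
            t ^ (-1 - s * p)) := by
        refine le_trans (setLIntegral_le_lintegral _ _) (lintegral_mono fun y => ?_)
        refine lintegral_mono fun t => le_of_eq ?_
        rw [abs_sub_comm, add_assoc, ← add_smul, hg]
        simp only
        rw [show b - (y - t) = b - y + t by ring]
    _ = _ := lintegral_sub_left_eq_self (fun τ : ℝ => ∫⁻ t in Ioi (0 : ℝ),
          ENNReal.ofReal (|u (x + τ • w + t • w) - u (x + τ • w)| ^ p * t ^ (-1 - s * p))) b

/-- The Hardy inequality in a fixed direction. -/
theorem hardy_direction (hs : s ∈ Ioo (0 : ℝ) 1) (hp : 1 < p) {K : Opens (Eucl N)} (u : 𝓓(K, ℝ))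
    {w : Eucl N} (hw : w ≠ 0) :
    ENNReal.ofReal (lineConst p / (s * (1 - s))) *
        ∫⁻ x, ENNReal.ofReal (|u x| ^ p) / exitTime K x w ^ (s * p)
      ≤ ∫⁻ x, ∫⁻ t in Ioi (0 : ℝ),
          ENNReal.ofReal (|u (x + t • w) - u x| ^ p * t ^ (-1 - s * p)) := by
  have hum := u.continuous.measurable
  have he := measurable_exitTime_left K w
  have hm : Measurable fun z : Eucl N × ℝ =>
      ENNReal.ofReal (|u (z.1 + z.2 • w) - u z.1| ^ p * z.2 ^ (-1 - s * p)) := by fun_prop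
  have hH : Measurable fun x => ENNReal.ofReal (|u x| ^ p) / exitTime K x w ^ (s * p) := by
    fun_prop
  have hG : Measurable fun x => ∫⁻ t in Ioi (0 : ℝ),
      ENNReal.ofReal (|u (x + t • w) - u x| ^ p * t ^ (-1 - s * p)) :=
    hm.lintegral_prod_right'
  rw [lintegral_lines hw hH, lintegral_lines hw hG,
    ← lintegral_const_mul' _ _ ENNReal.ofReal_ne_top]
  exact lintegral_mono fun x => hardy_line hs hp u x hw

theorem energy_eq_lintegral_lintegral {u : Eucl N → ℝ} (hu : Continuous u) :
    energy s p u = ∫⁻ x, ∫⁻ h,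
      ENNReal.ofReal (|u (x + h) - u x| ^ p / ‖h‖ ^ ((N : ℝ) + s * p)) := by
  have := hu.measurable
  rw [energy, Measure.volume_eq_prod, lintegral_prod_symm _ (by fun_prop)]
  refine lintegral_congr fun x => ?_
  rw [← lintegral_add_left_eq_self _ x]
  simp_rw [add_sub_cancel_left]

/-- In the coordinates `h = t • w` the energy kernel differs from the one-dimensional one by `‖w‖ ^
(N + s * p)`, which the shell bounds by `2 ^ (N + p)`, uniformly in `s`. -/
theorem shell_lintegral_le_energy (hN : 1 ≤ N) (hs : s ∈ Ioo (0 : ℝ) 1) (hp : 1 < p)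
    {u : Eucl N → ℝ} (hu : Continuous u) :
    ENNReal.ofReal (((2 : ℝ) ^ ((N : ℝ) + p))⁻¹) *
        ∫⁻ w in {w : Eucl N | 1 < ‖w‖ ∧ ‖w‖ < 2}, ∫⁻ x, ∫⁻ t in Ioi (0 : ℝ),
          ENNReal.ofReal (|u (x + t • w) - u x| ^ p * t ^ (-1 - s * p))
      ≤ ENNReal.ofReal (Real.log 2) * energy s p u := by
  have hp0 : 0 < p := by linarith
  have hum := hu.measurable
  have hA : MeasurableSet {w : Eucl N | 1 < ‖w‖ ∧ ‖w‖ < 2} :=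
    (measurableSet_lt measurable_const measurable_norm).inter
      (measurableSet_lt measurable_norm measurable_const)
  have hm : Measurable fun z : (Eucl N × Eucl N) × ℝ =>
      ENNReal.ofReal (|u (z.1.2 + z.2 • z.1.1) - u z.1.2| ^ p * z.2 ^ (-1 - s * p)) := by
    fun_prop
  rw [lintegral_lintegral_swap hm.lintegral_prod_right'.aemeasurable,
    energy_eq_lintegral_lintegral hu, ← lintegral_const_mul' _ _ ENNReal.ofReal_ne_top,
    ← lintegral_const_mul' _ _ ENNReal.ofReal_ne_top]
  refine lintegral_mono fun x => ?_
  simp only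
  rw [← lintegral_shell hN (by fun_prop), ← lintegral_const_mul' _ _ ENNReal.ofReal_ne_top]
  refine setLIntegral_mono' hA fun w hw => ?_
  rw [← lintegral_const_mul' _ _ ENNReal.ofReal_ne_top]
  refine setLIntegral_mono' measurableSet_Ioi fun t (ht : 0 < t) => ?_
  have hw1 : 1 < ‖w‖ := hw.1
  have hw2 : ‖w‖ < 2 := hw.2
  have hw0 : 0 < ‖w‖ := by linarith
  have hNsp : 0 ≤ (N : ℝ) + s * p := by have := hs.1; positivity
  rw [← ENNReal.ofReal_mul (by positivity), ← ENNReal.ofReal_mul (by positivity)]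
  refine ENNReal.ofReal_le_ofReal ?_
  rw [norm_smul, Real.norm_of_nonneg ht.le, Real.mul_rpow ht.le hw0.le]
  have hle : ‖w‖ ^ ((N : ℝ) + s * p) ≤ 2 ^ ((N : ℝ) + p) :=
    (Real.rpow_le_rpow hw0.le hw2.le hNsp).trans
      (Real.rpow_le_rpow_of_exponent_le one_le_two (by nlinarith [hs.2]))
  have ht' : t ^ (-1 - s * p) = t ^ ((N : ℝ) - 1) / t ^ ((N : ℝ) + s * p) := by
    rw [← Real.rpow_sub ht]; ring_nf
  calc _ = t ^ ((N : ℝ) - 1) * (|u (x + t • w) - u x| ^ p /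
        (t ^ ((N : ℝ) + s * p) * 2 ^ ((N : ℝ) + p))) := by
        rw [ht']; field_simp
    _ ≤ _ := by gcongr

/-- The constant of the Hardy inequality on convex sets. -/
noncomputable def hardyConst (N : ℕ) (p : ℝ) : ℝ :=
  ((2 : ℝ) ^ ((N : ℝ) + p))⁻¹ * lineConst p *
    (volume (Metric.ball (0 : Eucl N) (1 / 2))).toReal / Real.log 2

theorem isHardyConstant_hardyConst (hN : 1 ≤ N) (hp : 1 < p) :
    IsHardyConstant N p (hardyConst N p) := by
  have hp0 : 0 < p := by linarith
  have hl2 : 0 < Real.log 2 := Real.log_pos one_lt_two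
  have hlc := lineConst_pos hp
  set V := volume (Metric.ball (0 : Eucl N) (1 / 2)) with hV
  have hVt : V ≠ ∞ := measure_ball_lt_top.ne
  have hV0 : 0 < V.toReal :=
    ENNReal.toReal_pos (Metric.measure_ball_pos _ _ (by norm_num)).ne' hVt
  refine ⟨by unfold hardyConst; positivity, fun s hs K hK hne u => ?_⟩
  have hum := u.continuous.measurable
  have hs' : 0 < s * (1 - s) := mul_pos hs.1 (sub_pos.2 hs.2)
  have hA : MeasurableSet {w : Eucl N | 1 < ‖w‖ ∧ ‖w‖ < 2} :=
    (measurableSet_lt measurable_const measurable_norm).inter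
      (measurableSet_lt measurable_norm measurable_const)
  have he := measurable_exitTime K
  have hmul : ENNReal.ofReal (hardyConst N p / (s * (1 - s))) =
      ENNReal.ofReal (Real.log 2)⁻¹ * (ENNReal.ofReal (((2 : ℝ) ^ ((N : ℝ) + p))⁻¹) *
        (ENNReal.ofReal (lineConst p / (s * (1 - s))) * V)) := by
    rw [← ENNReal.ofReal_toReal hVt, ← ENNReal.ofReal_mul (by positivity),
      ← ENNReal.ofReal_mul (by positivity), ← ENNReal.ofReal_mul (by positivity)]
    congr 1
    unfold hardyConst
    ring
  -- The good velocities depend on `x`, but they contain a ball of volume `V` for every `x`;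
  -- exchanging the integrals therefore loses only this factor.
  have hdir : V * ∫⁻ x in (K : Set (Eucl N)), ENNReal.ofReal (|u x| ^ p) / bdryDist K x ^ (s * p)
      ≤ ∫⁻ w in {w : Eucl N | 1 < ‖w‖ ∧ ‖w‖ < 2},
          ∫⁻ x, ENNReal.ofReal (|u x| ^ p) / exitTime K x w ^ (s * p) := by
    have hm : Measurable fun z : Eucl N × Eucl N =>
        ENNReal.ofReal (|u z.2| ^ p) / exitTime K z.2 z.1 ^ (s * p) := by
      have := he.comp measurable_swap
      simp only [Function.comp_def, Prod.fst_swap, Prod.snd_swap] at this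
      fun_prop
    rw [lintegral_lintegral_swap hm.aemeasurable, ← lintegral_const_mul' _ _ hVt]
    refine le_trans (setLIntegral_mono' K.isOpen.measurableSet fun x hx => ?_)
      (setLIntegral_le_lintegral _ _)
    obtain ⟨c, hcA, hc⟩ := exists_exitTime_le hK hne hx
    calc _ = ∫⁻ w in Metric.ball c (1 / 2),
          ENNReal.ofReal (|u x| ^ p) / bdryDist K x ^ (s * p) := by
          rw [setLIntegral_const, hV, Measure.addHaar_ball_center volume c, mul_comm]
      _ ≤ ∫⁻ w in Metric.ball c (1 / 2),
          ENNReal.ofReal (|u x| ^ p) / exitTime K x w ^ (s * p) := by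
          refine setLIntegral_mono' measurableSet_ball fun w hw => ?_
          have hsp : 0 ≤ s * p := by have := hs.1; positivity
          gcongr
          exact hc w hw
      _ ≤ _ := lintegral_mono_set hcA
  rw [hmul]
  have hmain := shell_lintegral_le_energy hN hs hp u.continuous
  calc _ = ENNReal.ofReal (Real.log 2)⁻¹ * (ENNReal.ofReal (((2 : ℝ) ^ ((N : ℝ) + p))⁻¹) *
        (ENNReal.ofReal (lineConst p / (s * (1 - s))) * (V *
          ∫⁻ x in (K : Set (Eucl N)), ENNReal.ofReal (|u x| ^ p) / bdryDist K x ^ (s * p)))) := by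
        simp only [mul_assoc]
    _ ≤ ENNReal.ofReal (Real.log 2)⁻¹ * (ENNReal.ofReal (Real.log 2) * energy s p u) := by
        refine mul_le_mul_right (le_trans ?_ hmain) _
        refine mul_le_mul_right ?_ _
        refine le_trans (mul_le_mul_right hdir _) ?_
        rw [← lintegral_const_mul' _ _ ENNReal.ofReal_ne_top]
        refine setLIntegral_mono' hA fun w hw => ?_
        refine hardy_direction hs hp u ?_
        rintro rfl
        have := hw.1
        norm_num at this
    _ = energy s p u := by
        rw [← mul_assoc, ← ENNReal.ofReal_mul (by positivity), inv_mul_cancel₀ hl2.ne',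
          ENNReal.ofReal_one, one_mul]

/-! ### Poincaré inequality and the first eigenvalue. -/

theorem ne_univ_of_inradius_lt_top {K : Opens (Eucl N)} (hne : (K : Set (Eucl N)).Nonempty)
    (hR : inradius K < ∞) : (K : Set (Eucl N)) ≠ univ := by
  intro h
  obtain ⟨x, hx⟩ := hne
  have h1 : bdryDist K x ≤ inradius K := le_iSup₂ (f := fun x (_ : x ∈ K) => bdryDist K x) x hx
  rw [bdryDist, h, frontier_univ, Metric.infEDist_empty] at h1
  exact hR.ne (top_le_iff.1 h1)

/-- The Poincaré inequality that follows from the Hardy inequality. -/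
theorem IsHardyConstant.poincare {C : ℝ} (hC : IsHardyConstant N p C) (hp : 1 < p)
    (hs : s ∈ Ioo (0 : ℝ) 1) {K : Opens (Eucl N)} (hK : Convex ℝ (K : Set (Eucl N)))
    (hne : (K : Set (Eucl N)).Nonempty) (hR : inradius K < ∞) (u : 𝓓(K, ℝ)) :
    ENNReal.ofReal C / inradius K ^ (s * p) *
        ∫⁻ x in (K : Set (Eucl N)), ENNReal.ofReal (|u x| ^ p)
      ≤ ENNReal.ofReal (s * (1 - s)) * energy s p u := by
  have hs' : 0 < s * (1 - s) := mul_pos hs.1 (sub_pos.2 hs.2)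
  have hsp : 0 ≤ s * p := mul_nonneg hs.1.le (by linarith)
  have hum := u.continuous.measurable
  have h1 := hC.2 s hs K hK (ne_univ_of_inradius_lt_top hne hR) u
  calc _ = ENNReal.ofReal C * ∫⁻ x in (K : Set (Eucl N)),
        ENNReal.ofReal (|u x| ^ p) / inradius K ^ (s * p) := by
        simp_rw [div_eq_mul_inv]
        rw [lintegral_mul_const _ (by fun_prop), mul_assoc, mul_comm (∫⁻ _, _ ∂_)]
    _ ≤ ENNReal.ofReal C * ∫⁻ x in (K : Set (Eucl N)),
        ENNReal.ofReal (|u x| ^ p) / bdryDist K x ^ (s * p) := by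
        refine mul_le_mul_right (setLIntegral_mono' K.isOpen.measurableSet fun x hx => ?_) _
        gcongr
        exact le_iSup₂ (f := fun x (_ : x ∈ K) => bdryDist K x) x hx
    _ = ENNReal.ofReal (s * (1 - s)) * (ENNReal.ofReal (C / (s * (1 - s))) *
        ∫⁻ x in (K : Set (Eucl N)), ENNReal.ofReal (|u x| ^ p) / bdryDist K x ^ (s * p)) := by
        rw [← mul_assoc, ← ENNReal.ofReal_mul hs'.le, mul_div_cancel₀ _ hs'.ne']
    _ ≤ _ := mul_le_mul_right h1 _

theorem IsHardyConstant.le_firstEigenvalue {C : ℝ} (hC : IsHardyConstant N p C) (hp : 1 < p)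
    (hs : s ∈ Ioo (0 : ℝ) 1) {K : Opens (Eucl N)} (hK : Convex ℝ (K : Set (Eucl N)))
    (hne : (K : Set (Eucl N)).Nonempty) (hR : inradius K < ∞) :
    ENNReal.ofReal C / inradius K ^ (s * p) ≤
      ENNReal.ofReal (s * (1 - s)) * firstEigenvalue s p K := by
  have hs' : 0 < s * (1 - s) := mul_pos hs.1 (sub_pos.2 hs.2)
  rw [← ENNReal.div_le_iff' (by simpa using hs') ENNReal.ofReal_ne_top]
  refine le_iInf₂ fun u hu => ?_
  rw [ENNReal.div_le_iff' (by simpa using hs') ENNReal.ofReal_ne_top]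
  have h := hC.poincare hp hs hK hne hR u
  -- The Bochner integral is `0` for non-integrable functions, so the value `1` already forces
  -- integrability.
  rwa [← ofReal_integral_eq_lintegral_ofReal (integrable_of_integral_eq_one hu)
    (Filter.Eventually.of_forall fun x => by positivity), hu, ENNReal.ofReal_one, mul_one] at h

/-! ### Embedding of the completion in `L^p`. -/

theorem memLp_test {K : Opens (Eucl N)} (u : 𝓓(K, ℝ)) :
    MemLp u (ENNReal.ofReal p) (volume.restrict (K : Set (Eucl N))) :=
  u.continuous.memLp_of_hasCompactSupport u.hasCompactSupport

variable (p) in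
/-- Test functions as elements of `L^p`. -/
noncomputable def testToLp (K : Opens (Eucl N)) :
    𝓓(K, ℝ) →ₗ[ℝ] Lp ℝ (ENNReal.ofReal p) (volume.restrict (K : Set (Eucl N))) where
  toFun u := MemLp.toLp u (memLp_test u)
  map_add' _ _ := MemLp.toLp_add _ _
  map_smul' _ _ := MemLp.toLp_const_smul _ _

theorem coeFn_testToLp {K : Opens (Eucl N)} (u : 𝓓(K, ℝ)) :
    testToLp p K u =ᵐ[volume.restrict (K : Set (Eucl N))] u :=
  MemLp.coeFn_toLp (memLp_test u)

theorem memLp_diffQuot (hs : s ∈ Ioo (0 : ℝ) 1) (hp : 1 < p) {K : Opens (Eucl N)}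
    (u : 𝓓(K, ℝ)) : MemLp (diffQuot s p u) (ENNReal.ofReal p) volume :=
  ⟨(measurable_diffQuot u.continuous).aestronglyMeasurable,
    lt_top_iff_ne_top.2 (eLpNorm_diffQuot_ne_top hs hp u)⟩

/-- The difference quotients of test functions as elements of `L^p`. -/
noncomputable def diffQuotToLp (hs : s ∈ Ioo (0 : ℝ) 1) (hp : 1 < p) (K : Opens (Eucl N)) :
    𝓓(K, ℝ) →ₗ[ℝ] Lp ℝ (ENNReal.ofReal p) (volume : Measure (Eucl N × Eucl N)) where
  toFun u := MemLp.toLp (diffQuot s p u) (memLp_diffQuot hs hp u)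
  map_add' u v := by
    rw [← MemLp.toLp_add]
    congr 1
    funext z
    simp only [diffQuot, FunLike.coe_add, Pi.add_apply]
    ring
  map_smul' c u := by
    rw [RingHom.id_apply, ← MemLp.toLp_const_smul]
    congr 1
    funext z
    simp only [diffQuot, FunLike.coe_smul, Pi.smul_apply, smul_eq_mul]
    ring

theorem coeFn_diffQuotToLp (hs : s ∈ Ioo (0 : ℝ) 1) (hp : 1 < p) {K : Opens (Eucl N)}
    (u : 𝓓(K, ℝ)) : diffQuotToLp hs hp K u =ᵐ[volume] diffQuot s p u :=
  MemLp.coeFn_toLp (memLp_diffQuot hs hp u)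

theorem norm_diffQuotToLp (hs : s ∈ Ioo (0 : ℝ) 1) (hp : 1 < p) {K : Opens (Eucl N)}
    (u : 𝓓(K, ℝ)) : ‖diffQuotToLp hs hp K u‖ = gagliardo s p u := by
  rw [gagliardo_eq hp]
  exact Lp.norm_toLp _ (memLp_diffQuot hs hp u)

theorem exists_norm_testToLp_le (hN : 1 ≤ N) (hs : s ∈ Ioo (0 : ℝ) 1) (hp : 1 < p)
    {K : Opens (Eucl N)} (hK : Convex ℝ (K : Set (Eucl N)))
    (hne : (K : Set (Eucl N)).Nonempty) (hR : inradius K < ∞) :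
    ∃ M : ℝ, ∀ u : 𝓓(K, ℝ), ‖testToLp p K u‖ ≤ M * gagliardo s p u := by
  have hp0 : 0 < p := by linarith
  have hs' : 0 < s * (1 - s) := mul_pos hs.1 (sub_pos.2 hs.2)
  have hsp : 0 < s * p := mul_pos hs.1 hp0
  have hC := isHardyConstant_hardyConst hN hp
  set a := ENNReal.ofReal (hardyConst N p) / inradius K ^ (s * p) with ha
  have ha0 : a ≠ 0 := by
    rw [ha, ne_eq, ENNReal.div_eq_zero_iff, not_or]
    exact ⟨by simpa using hC.1, ENNReal.rpow_ne_top_of_nonneg hsp.le hR.ne⟩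
  set A := a⁻¹ * ENNReal.ofReal (s * (1 - s)) with hA
  have hAt : A ≠ ∞ := ENNReal.mul_ne_top (ENNReal.inv_ne_top.2 ha0) ENNReal.ofReal_ne_top
  refine ⟨(A ^ (1 / p)).toReal, fun u => ?_⟩
  have hE := (energy_lt_top hs hp u).ne
  have hle : ∫⁻ x in (K : Set (Eucl N)), ENNReal.ofReal (|u x| ^ p) ≤ A * energy s p u := by
    have h := hC.poincare hp hs hK hne hR u
    rw [← ha] at h
    have h2 := mul_le_mul_right h a⁻¹
    -- The value `a = ∞` corresponds to inradius zero. It need not be excluded: the finite energy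
    -- then forces the integral of `|u| ^ p` to vanish.
    rcases eq_or_ne a ∞ with hat | hat
    · have hfin : ENNReal.ofReal (s * (1 - s)) * energy s p u ≠ ∞ :=
        ENNReal.mul_ne_top ENNReal.ofReal_ne_top hE
      rw [hat] at h
      have h0 : ∫⁻ x in (K : Set (Eucl N)), ENNReal.ofReal (|u x| ^ p) = 0 := by
        by_contra h0
        rw [ENNReal.top_mul h0] at h
        exact hfin (top_le_iff.1 h)
      rw [h0]
      exact zero_le
    · rwa [← mul_assoc, ENNReal.inv_mul_cancel ha0 hat, one_mul, ← mul_assoc] at h2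
  have hnorm : ‖testToLp p K u‖ =
      ((∫⁻ x in (K : Set (Eucl N)), ENNReal.ofReal (|u x| ^ p)) ^ (1 / p)).toReal := by
    refine (Lp.norm_toLp _ (memLp_test u)).trans ?_
    rw [eLpNorm_eq_lintegral_rpow_enorm_toReal (by simpa using hp0) ENNReal.ofReal_ne_top,
      ENNReal.toReal_ofReal hp0.le]
    congr 2
    refine lintegral_congr fun x => ?_
    rw [Real.enorm_eq_ofReal_abs, ENNReal.ofReal_rpow_of_nonneg (abs_nonneg _) hp0.le]
  rw [hnorm, gagliardo, ENNReal.toReal_rpow, ← ENNReal.toReal_mul,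
    ← ENNReal.mul_rpow_of_nonneg _ _ (by positivity)]
  exact ENNReal.toReal_mono (ENNReal.rpow_ne_top_of_nonneg (by positivity)
    (ENNReal.mul_ne_top hAt hE)) (ENNReal.rpow_le_rpow hle (by positivity))

/-- Linear maps that are bounded for the Gagliardo seminorm extend to the completion. -/
theorem exists_extension (hs : s ∈ Ioo (0 : ℝ) 1) (hp : 1 < p) {K : Opens (Eucl N)}
    {F : Type*} [NormedAddCommGroup F] [NormedSpace ℝ F] [CompleteSpace F]
    (T : 𝓓(K, ℝ) →ₗ[ℝ] F) {M : ℝ} (hT : ∀ u : 𝓓(K, ℝ), ‖T u‖ ≤ M * gagliardo s p u) :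
    ∃ J : D0 hs hp K →L[ℝ] F, ∀ u : 𝓓(K, ℝ), J (D0.ofTest hs hp K u) = T u := by
  let T₁ : GagliardoTest hs hp K →ₗ[ℝ] F :=
    { toFun := fun u => T u
      map_add' := fun u v => T.map_add u v
      map_smul' := fun c u => T.map_smul c u }
  let T₂ : GagliardoTest hs hp K →L[ℝ] F := T₁.mkContinuous M hT
  refine ⟨T₂.extend UniformSpace.Completion.toComplL, fun u => ?_⟩
  exact T₂.extend_eq UniformSpace.Completion.denseRange_coe
    (UniformSpace.Completion.isUniformInducing_coe _) u

/-- Test functions vanish off `K`, so the convergence holds almost everywhere in the whole space;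
null sets pull back to null sets under both projections of the product. -/
theorem tendsto_diffQuot_zero {K : Opens (Eucl N)} {u : ℕ → 𝓓(K, ℝ)}
    (h : ∀ᵐ x ∂volume.restrict (K : Set (Eucl N)),
      Filter.Tendsto (fun n => u n x) Filter.atTop (nhds 0)) :
    ∀ᵐ z : Eucl N × Eucl N,
      Filter.Tendsto (fun n => diffQuot s p (u n) z) Filter.atTop (nhds 0) := by
  have hall : ∀ᵐ x : Eucl N, Filter.Tendsto (fun n => u n x) Filter.atTop (nhds 0) := by
    filter_upwards [(ae_restrict_iff' K.isOpen.measurableSet).1 h] with x hx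
    by_cases hxK : x ∈ (K : Set (Eucl N))
    · exact hx hxK
    · have h0 : ∀ n, u n x = 0 := fun n =>
        image_eq_zero_of_notMem_tsupport fun h => hxK ((u n).tsupport_subset h)
      simp only [h0]
      exact tendsto_const_nhds
  have h1 := (Measure.quasiMeasurePreserving_fst (μ := (volume : Measure (Eucl N)))
    (ν := (volume : Measure (Eucl N)))).ae hall
  have h2 := (Measure.quasiMeasurePreserving_snd (μ := (volume : Measure (Eucl N)))
    (ν := (volume : Measure (Eucl N)))).ae hall
  rw [Measure.volume_eq_prod]
  filter_upwards [h1, h2] with z hz1 hz2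
  simpa [diffQuot] using (hz1.sub hz2).div_const (‖z.1 - z.2‖ ^ (((N : ℝ) + s * p) / p))

/-- Any bounded map of the completion into `L^p` that extends the identity is injective. -/
theorem injective_of_extends [Fact (1 ≤ ENNReal.ofReal p)] (hs : s ∈ Ioo (0 : ℝ) 1) (hp : 1 < p)
    {K : Opens (Eucl N)}
    (J : D0 hs hp K →L[ℝ] Lp ℝ (ENNReal.ofReal p) (volume.restrict (K : Set (Eucl N))))
    (hJ : ∀ u : 𝓓(K, ℝ), J (D0.ofTest hs hp K u) = testToLp p K u) :
    Function.Injective J := by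
  -- `Q` extends an isometry, so it suffices to prove `Q w = 0` whenever `J w = 0`.
  obtain ⟨Q, hQ⟩ := exists_extension hs hp (diffQuotToLp hs hp K) (M := 1) fun u => by
    rw [norm_diffQuotToLp, one_mul]
  rw [injective_iff_map_eq_zero]
  intro w hw
  obtain ⟨x, hx, hxw⟩ := mem_closure_iff_seq_limit.1 (D0.denseRange_ofTest hs hp K w)
  choose u hu using hx
  obtain rfl : (fun n => D0.ofTest hs hp K (u n)) = x := funext hu
  have hJ0 : Filter.Tendsto (fun n => testToLp p K (u n)) Filter.atTop (nhds 0) := by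
    have := (J.continuous.tendsto w).comp hxw
    rw [hw] at this
    simpa only [Function.comp_def, hJ] using this
  have hQw : Filter.Tendsto (fun n => diffQuotToLp hs hp K (u n)) Filter.atTop (nhds (Q w)) := by
    have := (Q.continuous.tendsto w).comp hxw
    simpa only [Function.comp_def, hQ] using this
  have hnorm : ‖Q w‖ = ‖w‖ := by
    refine tendsto_nhds_unique hQw.norm ?_
    have := hxw.norm
    simpa only [D0.norm_ofTest, norm_diffQuotToLp] using this
  -- Two successive extractions: along `φ` the difference quotients converge almost everywhere to `Q
  -- w`, and along the further `ψ` the functions themselves tend to zero almost everywhere on `K`.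
  -- Uniqueness of pointwise limits gives `Q w = 0`.
  obtain ⟨φ, hφ, hφw⟩ := (tendstoInMeasure_of_tendsto_Lp hQw).exists_seq_tendsto_ae
  obtain ⟨ψ, hψ, hψ0⟩ := (tendstoInMeasure_of_tendsto_Lp
    (hJ0.comp hφ.tendsto_atTop)).exists_seq_tendsto_ae
  have hae : ∀ᵐ y ∂volume.restrict (K : Set (Eucl N)),
      Filter.Tendsto (fun n => u (φ (ψ n)) y) Filter.atTop (nhds 0) := by
    have h1 : ∀ᵐ y ∂volume.restrict (K : Set (Eucl N)), ∀ n, testToLp p K (u n) y = u n y :=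
      ae_all_iff.2 fun n => coeFn_testToLp (u n)
    filter_upwards [hψ0, h1, Lp.coeFn_zero ℝ (ENNReal.ofReal p)
      (volume.restrict (K : Set (Eucl N)))] with y hy hy1 hy0
    rw [hy0] at hy
    simpa only [Function.comp_apply, hy1, Pi.zero_apply] using hy
  have hQ0 : Q w = 0 := by
    rw [Lp.eq_zero_iff_ae_eq_zero]
    have h1 : ∀ᵐ z : Eucl N × Eucl N, ∀ n, diffQuotToLp hs hp K (u n) z = diffQuot s p (u n) z :=
      ae_all_iff.2 fun n => coeFn_diffQuotToLp hs hp (u n)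
    filter_upwards [hφw, h1, tendsto_diffQuot_zero (s := s) (p := p) hae] with z hz hz1 hz0
    simp only [hz1] at hz
    exact tendsto_nhds_unique (hz.comp hψ.tendsto_atTop) hz0
  rwa [hQ0, norm_zero, eq_comm, norm_eq_zero] at hnorm

end FracHardy

theorem corollary5p1 (N : ℕ) (hN : 1 ≤ N) (p : ℝ) (hp : 1 < p) :
    -- the constant `C = C(N, p)` of the Hardy inequality on convex sets exists
    (∃ C : ℝ, FracHardy.IsHardyConstant N p C) ∧
    ∀ (s : ℝ) (hs : s ∈ Ioo (0 : ℝ) 1) (K : Opens (FracHardy.Eucl N)),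
      Convex ℝ (K : Set (FracHardy.Eucl N)) → (K : Set (FracHardy.Eucl N)).Nonempty →
      FracHardy.inradius K < ∞ →
      -- `D_0^{s,p}(K)` is a space of functions, continuously embedded in `L^p(K)`
      (∃ J : FracHardy.D0 hs hp K →ₗ[ℝ]
            Lp ℝ (ENNReal.ofReal p) (volume.restrict (K : Set (FracHardy.Eucl N))),
          Function.Injective J ∧
          (∃ M : ℝ, ∀ w : FracHardy.D0 hs hp K, ‖J w‖ ≤ M * ‖w‖) ∧
          ∀ u : 𝓓(K, ℝ), J (FracHardy.D0.ofTest hs hp K u)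
            =ᵐ[volume.restrict (K : Set (FracHardy.Eucl N))] u) ∧
      -- lower bound on the first eigenvalue, with the constant of the Hardy inequality
      ∀ C : ℝ, FracHardy.IsHardyConstant N p C →
        ENNReal.ofReal C / FracHardy.inradius K ^ (s * p) ≤
          ENNReal.ofReal (s * (1 - s)) * FracHardy.firstEigenvalue s p K := by
  refine ⟨⟨_, FracHardy.isHardyConstant_hardyConst hN hp⟩, fun s hs K hK hne hR =>
    ⟨?_, fun C hC => hC.le_firstEigenvalue hp hs hK hne hR⟩⟩
  have : Fact (1 ≤ ENNReal.ofReal p) := ⟨by simpa using hp.le⟩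
  obtain ⟨M, hM⟩ := FracHardy.exists_norm_testToLp_le hN hs hp hK hne hR
  obtain ⟨J, hJ⟩ := FracHardy.exists_extension hs hp (FracHardy.testToLp p K) hM
  refine ⟨J.toLinearMap, FracHardy.injective_of_extends hs hp J hJ, ⟨‖J‖, J.le_opNorm⟩,
    fun u => ?_⟩
  have h : J.toLinearMap (FracHardy.D0.ofTest hs hp K u) = FracHardy.testToLp p K u := hJ u
  rw [h]
  exact FracHardy.coeFn_testToLp u
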